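/- Let $A$ and $B$ be associative rings with identity, let $U$ be a $(B,A)$-bimodule, and let $T=\begin{pmatrix} A & 0\\ U & B\end{pmatrix}$ be the triangular matrix ring. Assume that $U_A$ has finite flat dimension and that ${}_BU$ has finite projective dimension. Let $M=\binom{M_1}{M_2}_{\varphi}$ be a left $T$-module, that is, $M_1$ is a left $A$-module, $M_2$ is a left $B$-module, $\varphi\colon U\otimes_A M_1\to M_2$ is a $B$-homomorphism, and $T$ acts by $\begin{pmatrix} a&0\\u&b\end{pmatrix}\binom{m_1}{m_2}=\binom{a m_1}{\varphi(u\otimes m_1)+b m_2}$. A ring $R$ is called left Gorenstein regular if the category of left $R$-modules is Gorenstein: a left $R$-module has finite projective dimension if and only if it has finite injective dimension, the finitistic projective and injective dimensions of the category are finite, and the category has a generator of finite projective dimension. A left $R$-module $X$ is Gorenstein projective if $X\cong\mathrm{Ker}(P^0\to P^1)$ for an exact sequence $\cdots\to P^{-1}\to P^0\to P^1\to\cdots$ of projective left $R$-modules that remains exact under $\mathrm{Hom}_R(-,Q)$ for every projective left $R$-module $Q$. It is Gorenstein injective if $X\cong\mathrm{Ker}(E^0\to E^1)$ for an exact sequence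 $\cdots\to E^{-1}\to E^0\to E^1\to\cdots$ of injective left $R$-modules that remains exact under $\mathrm{Hom}_R(I,-)$ for every injective left $R$-module $I$. The Gorenstein projective dimension $\mathrm{Gpd}(X)$ is the least $n\ge 0$ for which there is an exact sequence $0\to G_n\to\cdots\to G_0\to X\to 0$ with all $G_i$ Gorenstein projective, and $\infty$ if there is none; the Gorenstein injective dimension $\mathrm{Gid}(X)$ is the least $n\ge 0$ for which there is an exact sequence $0\to X\to G^0\to\cdots\to G^n\to 0$ with all $G^i$ Gorenstein injective, and $\infty$ if there is none. (1) Suppose that $B$ is left Gorenstein regular. Then $\mathrm{Gpd}(M)<\infty$ if and only if $\mathrm{Gpd}(M_1)<\infty$ and $\mathrm{Gpd}(M_2)<\infty$. (2) Suppose that $A$ is left Gorenstein regular. Then $\mathrm{Gid}(M)<\infty$ if and only if $\mathrm{Gid}(M_1)<\infty$ and $\mathrm{Gid}(M_2)<\infty$. Here the dimensions of $M$, $M_1$ and $M_2$ are taken over $T$, $A$ and $B$ respectively. -/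

import Mathlib

open CategoryTheory MulOpposite
open scoped TensorProduct

universe u

noncomputable section

namespace TriangularGorenstein

/-! ### Gorenstein categories and Gorenstein regular rings -/

/-- A Grothendieck category `C` is Gorenstein if the objects of finite projective dimension are
the objects of finite injective dimension, the finitistic projective and injective dimensions are
finite, and there is a generator of finite projective dimension. -/
structure IsGorensteinCategory (C : Type*) [Category.{u} C] [Abelian C]
    [IsGrothendieckAbelian.{u} C] : Prop where
  pd_finite_iff_id_finite (X : C) : projectiveDimension X < ⊤ ↔ injectiveDimension X < ⊤
  finitistic_pd : ∃ n : ℕ, ∀ X : C, projectiveDimension X < ⊤ → projectiveDimension X ≤ n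
  finitistic_id : ∃ n : ℕ, ∀ X : C, injectiveDimension X < ⊤ → injectiveDimension X ≤ n
  exists_generator : ∃ G : C, IsSeparator G ∧ projectiveDimension G < ⊤

/-- A ring `R` is left Gorenstein regular if the category of left `R`-modules is Gorenstein. -/
def LeftGorensteinRegular (R : Type u) [Ring R] : Prop :=
  IsGorensteinCategory (ModuleCat.{u} R)

/-! ### Gorenstein projective and Gorenstein injective modules -/

section Gorenstein

variable {R : Type u} [Ring R]

/-- `M` is Gorenstein projective: there is an exact sequence
`⋯ → P (-1) → P 0 → P 1 → ⋯` of projective modules which stays exact under `Hom(-, Q)` for every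
projective module `Q`, and such that `M ≅ Ker (P 0 → P 1)`. -/
def GorensteinProjective (M : ModuleCat.{u} R) : Prop :=
  ∃ (P : ℤ → ModuleCat.{u} R) (d : ∀ n : ℤ, P n →ₗ[R] P (n + 1)),
    (∀ n, Module.Projective R (P n)) ∧
    (∀ n, Function.Exact (d n) (d (n + 1))) ∧
    (∀ Q : ModuleCat.{u} R, Module.Projective R Q → ∀ n,
      Function.Exact (fun g : P (n + 1 + 1) →ₗ[R] Q => g ∘ₗ d (n + 1))
        (fun g : P (n + 1) →ₗ[R] Q => g ∘ₗ d n)) ∧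
    Nonempty (M ≃ₗ[R] LinearMap.ker (d 0))

/-- `M` is Gorenstein injective: there is an exact sequence
`⋯ → E (-1) → E 0 → E 1 → ⋯` of injective modules which stays exact under `Hom(I, -)` for every
injective module `I`, and such that `M ≅ Ker (E 0 → E 1)`. -/
def GorensteinInjective (M : ModuleCat.{u} R) : Prop :=
  ∃ (E : ℤ → ModuleCat.{u} R) (d : ∀ n : ℤ, E n →ₗ[R] E (n + 1)),
    (∀ n, Module.Injective R (E n)) ∧
    (∀ n, Function.Exact (d n) (d (n + 1))) ∧
    (∀ I : ModuleCat.{u} R, Module.Injective R I → ∀ n,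
      Function.Exact (fun g : I →ₗ[R] E n => d n ∘ₗ g)
        (fun g : I →ₗ[R] E (n + 1) => d (n + 1) ∘ₗ g)) ∧
    Nonempty (M ≃ₗ[R] LinearMap.ker (d 0))

/-- `HasResolution 𝒳 n M`: there is an exact sequence `0 → X n → ⋯ → X 0 → M → 0` whose terms `X i`
are in the class `𝒳`. For `n + 1` the sequence is cut at the kernel `K` of `X 0 → M`. -/
def HasResolution (𝒳 : ModuleCat.{u} R → Prop) : ℕ → ModuleCat.{u} R → Prop
  | 0, M => ∃ X : ModuleCat.{u} R, 𝒳 X ∧ Nonempty (X ≃ₗ[R] M)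
  | n + 1, M => ∃ (X K : ModuleCat.{u} R) (i : K →ₗ[R] X) (p : X →ₗ[R] M),
      𝒳 X ∧ HasResolution 𝒳 n K ∧
        Function.Injective i ∧ Function.Exact i p ∧ Function.Surjective p

/-- `HasCoresolution 𝒳 n M`: there is an exact sequence `0 → M → X 0 → ⋯ → X n → 0` whose terms
`X i` are in the class `𝒳`. For `n + 1` the sequence is cut at the cokernel `K` of `M → X 0`. -/
def HasCoresolution (𝒳 : ModuleCat.{u} R → Prop) : ℕ → ModuleCat.{u} R → Prop
  | 0, M => ∃ X : ModuleCat.{u} R, 𝒳 X ∧ Nonempty (M ≃ₗ[R] X)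
  | n + 1, M => ∃ (X K : ModuleCat.{u} R) (i : M →ₗ[R] X) (p : X →ₗ[R] K),
      𝒳 X ∧ HasCoresolution 𝒳 n K ∧
        Function.Injective i ∧ Function.Exact i p ∧ Function.Surjective p

/-- The least length of a resolution by modules in `𝒳`, and `⊤` if there is no finite one. -/
def resolutionDim (𝒳 : ModuleCat.{u} R → Prop) (M : ModuleCat.{u} R) : ℕ∞ :=
  ⨅ (n : ℕ) (_ : HasResolution 𝒳 n M), (n : ℕ∞)

/-- The least length of a coresolution by modules in `𝒳`, and `⊤` if there is no finite one. -/
def coresolutionDim (𝒳 : ModuleCat.{u} R → Prop) (M : ModuleCat.{u} R) : ℕ∞ :=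
  ⨅ (n : ℕ) (_ : HasCoresolution 𝒳 n M), (n : ℕ∞)

end Gorenstein

/-- The Gorenstein projective dimension of a left `R`-module. -/
def Gpd (R : Type u) [Ring R] (M : Type u) [AddCommGroup M] [Module R M] : ℕ∞ :=
  resolutionDim GorensteinProjective (ModuleCat.of R M)

/-- The Gorenstein injective dimension of a left `R`-module. -/
def Gid (R : Type u) [Ring R] (M : Type u) [AddCommGroup M] [Module R M] : ℕ∞ :=
  coresolutionDim GorensteinInjective (ModuleCat.of R M)

/-! ### Tensor products over a noncommutative ring, flat right modules -/

section Tensor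

variable (S A U M N : Type*) [Ring S] [Ring A] [AddCommGroup U] [Module S U] [Module Aᵐᵒᵖ U]
  [AddCommGroup M] [Module A M] [AddCommGroup N] [Module A N]

/-- The relations `u a ⊗ m - u ⊗ a m` in `U ⊗[ℤ] M`. -/
def balancingRelations : Set (U ⊗[ℤ] M) :=
  {x | ∃ (u : U) (a : A) (m : M), x = (op a • u) ⊗ₜ[ℤ] m - u ⊗ₜ[ℤ] (a • m)}

/-- The tensor product `U ⊗_A M` of a right `A`-module `U` and a left `A`-module `M`, as a left
`S`-module, where `U` is an `(S, A)`-bimodule. The `S`-span of the balancing relations is their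
additive span (see `smul_mem_balancingRelations`); take `S = ℤ` for a plain right module `U`. -/
abbrev BalancedTensor : Type _ :=
  (U ⊗[ℤ] M) ⧸ Submodule.span S (balancingRelations A U M)

variable {S A U M N}

theorem smul_mem_balancingRelations [SMulCommClass S Aᵐᵒᵖ U] (s : S) {x : U ⊗[ℤ] M}
    (hx : x ∈ balancingRelations A U M) : s • x ∈ balancingRelations A U M := by
  obtain ⟨u, a, m, rfl⟩ := hx
  exact ⟨s • u, a, m, by
    rw [smul_sub, TensorProduct.smul_tmul', TensorProduct.smul_tmul', smul_comm]⟩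

variable (S A) in
/-- The class of `u ⊗ m` in `U ⊗_A M`. -/
def btmul (u : U) (m : M) : BalancedTensor S A U M :=
  Submodule.Quotient.mk (u ⊗ₜ[ℤ] m)

variable (S A) in
theorem btmul_smul (u : U) (a : A) (m : M) :
    btmul S A u (a • m) = btmul S A (op a • u) m :=
  Eq.symm ((Submodule.Quotient.eq (Submodule.span S (balancingRelations A U M))).2
    (Submodule.subset_span ⟨u, a, m, rfl⟩))

variable (S A) in
theorem btmul_add (u : U) (m m' : M) :
    btmul S A u (m + m') = btmul S A u m + btmul S A u m' := by
  simp [btmul, TensorProduct.tmul_add]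

variable (S A) in
theorem add_btmul (u u' : U) (m : M) :
    btmul S A (u + u') m = btmul S A u m + btmul S A u' m := by
  simp [btmul, TensorProduct.add_tmul]

variable (A) in
theorem smul_btmul (s : S) (u : U) (m : M) :
    btmul S A (s • u) m = s • btmul S A u m := by
  simp only [btmul, ← Submodule.Quotient.mk_smul, TensorProduct.smul_tmul']

variable (A U) in
/-- The homomorphism `1 ⊗ f : U ⊗_A M → U ⊗_A N` of abelian groups. -/
def balancedMap (f : M →ₗ[A] N) : BalancedTensor ℤ A U M →ₗ[ℤ] BalancedTensor ℤ A U N :=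
  Submodule.mapQ _ _ (LinearMap.lTensor U (f.toAddMonoidHom.toIntLinearMap)) (by
    rw [Submodule.span_le]
    rintro _ ⟨u, a, m, rfl⟩
    refine Submodule.subset_span ⟨u, a, f m, ?_⟩
    simp)

end Tensor

/-- A right `A`-module `U` is flat: `U ⊗_A -` preserves injectivity of homomorphisms of left
`A`-modules. -/
def FlatRight {A : Type u} [Ring A] (U : ModuleCat.{u} Aᵐᵒᵖ) : Prop :=
  ∀ (X Y : ModuleCat.{u} A) (f : X →ₗ[A] Y), Function.Injective f →
    Function.Injective (balancedMap A U f)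

/-- The flat dimension of a right `A`-module. -/
def rightFlatDim (A : Type u) [Ring A] (U : Type u) [AddCommGroup U] [Module Aᵐᵒᵖ U] : ℕ∞ :=
  resolutionDim FlatRight (ModuleCat.of Aᵐᵒᵖ U)

/-! ### The triangular matrix ring and its left modules -/

/-- The elements of the triangular matrix ring `(A 0; U B)`. -/
@[ext]
structure TriRing (A U B : Type*) where
  /-- the upper left entry -/
  a : A
  /-- the lower left entry -/
  u : U
  /-- the lower right entry -/
  b : B

namespace TriRing

variable {A U B : Type*} [Ring A] [Ring B] [AddCommGroup U]

instance : Zero (TriRing A U B) := ⟨⟨0, 0, 0⟩⟩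
instance : One (TriRing A U B) := ⟨⟨1, 0, 1⟩⟩
instance : Add (TriRing A U B) := ⟨fun x y => ⟨x.a + y.a, x.u + y.u, x.b + y.b⟩⟩
instance : Neg (TriRing A U B) := ⟨fun x => ⟨-x.a, -x.u, -x.b⟩⟩

@[simp] theorem zero_a : (0 : TriRing A U B).a = 0 := rfl
@[simp] theorem zero_u : (0 : TriRing A U B).u = 0 := rfl
@[simp] theorem zero_b : (0 : TriRing A U B).b = 0 := rfl
@[simp] theorem one_a : (1 : TriRing A U B).a = 1 := rfl
@[simp] theorem one_u : (1 : TriRing A U B).u = 0 := rfl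
@[simp] theorem one_b : (1 : TriRing A U B).b = 1 := rfl
@[simp] theorem add_a (x y : TriRing A U B) : (x + y).a = x.a + y.a := rfl
@[simp] theorem add_u (x y : TriRing A U B) : (x + y).u = x.u + y.u := rfl
@[simp] theorem add_b (x y : TriRing A U B) : (x + y).b = x.b + y.b := rfl
@[simp] theorem neg_a (x : TriRing A U B) : (-x).a = -x.a := rfl
@[simp] theorem neg_u (x : TriRing A U B) : (-x).u = -x.u := rfl
@[simp] theorem neg_b (x : TriRing A U B) : (-x).b = -x.b := rfl

instance : AddCommGroup (TriRing A U B) where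
  add_assoc x y z := by ext <;> simp [add_assoc]
  zero_add x := by ext <;> simp
  add_zero x := by ext <;> simp
  add_comm x y := by ext <;> simp [add_comm]
  neg_add_cancel x := by ext <;> simp
  nsmul := nsmulRec
  zsmul := zsmulRec

variable [Module B U] [Module Aᵐᵒᵖ U]

/-- Matrix multiplication: `(a 0; u b) (a' 0; u' b') = (a a' 0; u a' + b u' b b')`. -/
instance : Mul (TriRing A U B) :=
  ⟨fun x y => ⟨x.a * y.a, op y.a • x.u + x.b • y.u, x.b * y.b⟩⟩

@[simp] theorem mul_a (x y : TriRing A U B) : (x * y).a = x.a * y.a := rfl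
@[simp] theorem mul_u (x y : TriRing A U B) : (x * y).u = op y.a • x.u + x.b • y.u := rfl
@[simp] theorem mul_b (x y : TriRing A U B) : (x * y).b = x.b * y.b := rfl

instance [SMulCommClass B Aᵐᵒᵖ U] : Ring (TriRing A U B) where
  __ := (inferInstance : AddCommGroup (TriRing A U B))
  mul_assoc x y z := by
    ext <;> simp [mul_assoc, mul_smul, add_assoc, smul_comm]
  one_mul x := by ext <;> simp
  mul_one x := by ext <;> simp
  zero_mul x := by ext <;> simp
  mul_zero x := by ext <;> simp
  left_distrib x y z := by
    ext
    · simp [mul_add]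
    · simp only [mul_u, add_a, add_u, MulOpposite.op_add, add_smul, smul_add]; abel
    · simp [mul_add]
  right_distrib x y z := by
    ext
    · simp [add_mul]
    · simp only [mul_u, add_b, add_u, add_smul, smul_add]; abel
    · simp [add_mul]
  zsmul := zsmulRec

end TriRing

section TriModule

variable {A B U M₁ M₂ : Type*} [Ring A] [Ring B]
  [AddCommGroup U] [Module B U] [Module Aᵐᵒᵖ U]
  [AddCommGroup M₁] [Module A M₁] [AddCommGroup M₂] [Module B M₂]

/-- The column `(M₁; M₂)_φ` given by a `B`-homomorphism `φ : U ⊗_A M₁ → M₂`. -/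
@[nolint unusedArguments]
def TriModule (_φ : BalancedTensor B A U M₁ →ₗ[B] M₂) : Type _ := M₁ × M₂

instance (φ : BalancedTensor B A U M₁ →ₗ[B] M₂) : AddCommGroup (TriModule φ) :=
  inferInstanceAs (AddCommGroup (M₁ × M₂))

/-- `(M₁; M₂)_φ` is a left module over the triangular matrix ring through
`(a 0; u b) (m₁; m₂) = (a m₁; φ (u ⊗ m₁) + b m₂)`. -/
instance [SMulCommClass B Aᵐᵒᵖ U] (φ : BalancedTensor B A U M₁ →ₗ[B] M₂) :
    Module (TriRing A U B) (TriModule φ) where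
  smul t m := ((t.a • m.1, φ (btmul B A t.u m.1) + t.b • m.2) : M₁ × M₂)
  one_smul m := Prod.ext (one_smul A m.1) (by
    change φ (btmul B A (0 : U) m.1) + (1 : B) • m.2 = m.2
    simp [btmul])
  mul_smul s t m := Prod.ext (mul_smul s.a t.a m.1) (by
    change φ (btmul B A (op t.a • s.u + s.b • t.u) m.1) + (s.b * t.b) • m.2 =
      φ (btmul B A s.u (t.a • m.1)) + s.b • (φ (btmul B A t.u m.1) + t.b • m.2)
    rw [add_btmul, map_add, smul_btmul, map_smul, btmul_smul, smul_add, mul_smul, add_assoc])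
  smul_zero t := Prod.ext (smul_zero t.a) (by
    change φ (btmul B A t.u (0 : M₁)) + t.b • (0 : M₂) = 0
    simp [btmul])
  smul_add t m n := Prod.ext (smul_add t.a m.1 n.1) (by
    change φ (btmul B A t.u (m.1 + n.1)) + t.b • (m.2 + n.2) =
      (φ (btmul B A t.u m.1) + t.b • m.2) + (φ (btmul B A t.u n.1) + t.b • n.2)
    rw [btmul_add, map_add, smul_add]; abel)
  add_smul s t m := Prod.ext (add_smul s.a t.a m.1) (by
    change φ (btmul B A (s.u + t.u) m.1) + (s.b + t.b) • m.2 =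
      (φ (btmul B A s.u m.1) + s.b • m.2) + (φ (btmul B A t.u m.1) + t.b • m.2)
    rw [add_btmul, map_add, add_smul]; abel)
  zero_smul m := Prod.ext (zero_smul A m.1) (by
    change φ (btmul B A (0 : U) m.1) + (0 : B) • m.2 = 0
    simp [btmul])

end TriModule

end TriangularGorenstein

end

open TriangularGorenstein

/-! A left Gorenstein regular ring has only modules of finite Gorenstein projective and injective
dimension (`LeftGorensteinRegular.fg`). So the condition on `M₂` in (1) and the condition on `M₁` in
(2) are automatic, and the claim becomes: the dimension of `M` is finite iff that of the remaining
component is.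

The category of `T`-modules is glued from those of `A` and `B` by exact sequences `0 → (0; M₂) → M →
(M₁; 0) → 0`. Write `e₁`, `e₂` for the two components, `i₁ X = (X; 0)`, `i₂ Y = (0; Y)`, `p X = (X;
U ⊗ X)` and `h N = (Hom_B(U, N); N)`. Then `p ⊣ e₁ ⊣ i₁` and `i₂ ⊣ e₂ ⊣ h`. A left adjoint preserves
Gorenstein projectives under mild exactness conditions, provided that its right adjoint sends
projectives to objects of finite projective dimension (`GP.map`). This applies to `e₁`, `i₂` and
`p`. Exactness of `e₁` gives one direction. Conversely, `i₁ G` is the cokernel of `i₂ (e₂ (p G)) → p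
G`, hence of finite Gorenstein dimension when `G` is Gorenstein projective, and `M` is an extension
of `i₁ M₁` by `i₂ M₂` (`fg_iff_of_gluing`).

The two hypotheses on `U` enter as follows. Finite flat dimension of `U_A` gives the character
module `Hom(U, ℚ/ℤ)` finite injective dimension, so `Ext¹(G, Hom(U, ℚ/ℤ)) = 0` for Gorenstein
projective `G`; this is `Tor₁(U, G) = 0` in dual form and makes `p` exact enough. Finite projective
dimension of `U` over `B` bounds that of `Q₂` for every projective column `Q`, because `Ext¹(U, N) =
0` forces `Ext¹(Q₂, N) = 0`.

Part (2) is the same argument in the opposite categories, where the two components exchange roles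
and `h` takes the place of `p`. -/

noncomputable section

namespace TriangularGorenstein

open Limits ZeroObject

universe w

/-! ### Short exact sequences and the horseshoe lemma in an abelian category -/

section ShortExactSequences

variable {C : Type*} [Category* C] [Abelian C]

/-- `0 → X → Y → Z → 0` is a short exact sequence. -/
def SES {X Y Z : C} (i : X ⟶ Y) (q : Y ⟶ Z) : Prop :=
  ∃ w : i ≫ q = 0, (ShortComplex.mk i q w).ShortExact

namespace SES

variable {X Y Z : C} {i : X ⟶ Y} {q : Y ⟶ Z}

theorem zero (h : SES i q) : i ≫ q = 0 := h.1

theorem mono (h : SES i q) : Mono i := h.2.mono_f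

theorem epi (h : SES i q) : Epi q := h.2.epi_g

theorem lift (h : SES i q) {W : C} (f : W ⟶ Y) (hf : f ≫ q = 0) : ∃ g : W ⟶ X, g ≫ i = f := by
  have := h.mono
  have hex := h.2.exact
  exact ⟨hex.lift f hf, hex.lift_f f hf⟩

theorem desc (h : SES i q) {W : C} (f : Y ⟶ W) (hf : i ≫ f = 0) : ∃ g : Z ⟶ W, q ≫ g = f := by
  have := h.epi
  have hex := h.2.exact
  exact ⟨hex.desc f hf, hex.g_desc f hf⟩

/-- A sequence in which the monomorphism `i` is a kernel of the epimorphism `q` is short exact. -/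
theorem of_lift (w : i ≫ q = 0) (hi : Mono i) (hq : Epi q)
    (hl : ∀ ⦃W : C⦄ (f : W ⟶ Y), f ≫ q = 0 → ∃ g : W ⟶ X, g ≫ i = f) : SES i q := by
  refine ⟨w, ShortComplex.ShortExact.mk' ?_ hi hq⟩
  rw [ShortComplex.exact_iff_exact_up_to_refinements]
  intro A x hx
  obtain ⟨g, hg⟩ := hl x hx
  exact ⟨A, 𝟙 A, inferInstance, g, by simpa using hg.symm⟩

theorem of_epi {Y Z : C} (q : Y ⟶ Z) [Epi q] : SES (kernel.ι q) q :=
  of_lift (kernel.condition q) inferInstance inferInstance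
    fun _ f hf => ⟨kernel.lift q f hf, kernel.lift_ι q f hf⟩

theorem op (h : SES i q) : SES q.op i.op :=
  ⟨by rw [← op_comp, h.zero, Limits.op_zero], h.2.op⟩

theorem unop {X Y Z : Cᵒᵖ} {i : X ⟶ Y} {q : Y ⟶ Z} (h : SES i q) : SES q.unop i.unop :=
  ⟨by rw [← unop_comp, h.zero, Limits.unop_zero], h.2.unop⟩

theorem of_mono {X Y : C} (i : X ⟶ Y) [Mono i] : SES i (cokernel.π i) :=
  ⟨cokernel.condition i, ShortComplex.ShortExact.mk' (ShortComplex.exact_cokernel i)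
    inferInstance inferInstance⟩

theorem iso_comp (h : SES i q) {X' : C} (e : X' ≅ X) : SES (e.hom ≫ i) q := by
  have := h.mono
  have := h.epi
  refine of_lift (by simp [h.zero]) inferInstance inferInstance fun W f hf => ?_
  obtain ⟨g, hg⟩ := h.lift f hf
  exact ⟨g ≫ e.inv, by simpa using hg⟩

theorem comp_iso (h : SES i q) {Z' : C} (e : Z ≅ Z') : SES i (q ≫ e.hom) := by
  have := h.mono
  have := h.epi
  refine of_lift (by simp [reassoc_of% h.zero]) inferInstance inferInstance fun W f hf => ?_
  refine h.lift f ?_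
  rwa [← Category.assoc, Preadditive.IsIso.comp_right_eq_zero] at hf

theorem map {D : Type*} [Category* D] [Abelian D] (F : C ⥤ D) [PreservesFiniteLimits F]
    [PreservesFiniteColimits F] (h : SES i q) : SES (F.map i) (F.map q) := by
  have := F.preservesZeroMorphisms_of_preserves_terminal_object
  exact ⟨by rw [← F.map_comp, h.zero, F.map_zero], h.2.map_of_exact F⟩

/-- A right exact functor carries a short exact sequence to a short exact sequence as soon as it
preserves the monomorphism. -/
theorem map_of_mono {D : Type*} [Category* D] [Abelian D] (F : C ⥤ D)
    [PreservesFiniteColimits F] (h : SES i q) (hF : Mono (F.map i)) :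
    SES (F.map i) (F.map q) := by
  have := preservesBinaryBiproducts_of_preservesBinaryCoproducts F
  have : F.Additive := Functor.additive_of_preservesBinaryBiproducts F
  have := h.epi
  exact ⟨by rw [← F.map_comp, h.zero, F.map_zero], ShortComplex.ShortExact.mk'
    (h.2.exact.map_of_epi_of_preservesCokernel F (by assumption) inferInstance) hF inferInstance⟩

end SES

/-- The horseshoe lemma: projective presentations of the ends of a short exact sequence, together
with a lift `l` of the second one, give a presentation of the middle term, and the
kernels form a short exact sequence. -/
theorem horseshoe {X Y Z P P' K K' : C} {a : X ⟶ Y} {b : Y ⟶ Z} (h : SES a b)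
    {k : K ⟶ P} {p : P ⟶ X} (hX : SES k p) {k' : K' ⟶ P'} {p' : P' ⟶ Z} (hZ : SES k' p')
    (l : P' ⟶ Y) (hl : l ≫ b = p') :
    ∃ (L : C) (j : L ⟶ P ⊞ P') (s : K ⟶ L) (t : L ⟶ K'),
      SES j (biprod.desc (p ≫ a) l) ∧ SES s t := by
  have := h.mono
  have := h.epi
  have := hX.mono
  have := hX.epi
  have := hZ.mono
  have := hZ.epi
  let d : P ⊞ P' ⟶ Y := biprod.desc (p ≫ a) l
  have hd : d = biprod.fst ≫ p ≫ a + biprod.snd ≫ l := by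
    apply biprod.hom_ext' <;> simp [d]
  have hdb : d ≫ b = biprod.snd ≫ p' := by
    apply biprod.hom_ext' <;> simp [d, h.zero, hl]
  have hepi : Epi d := by
    rw [epi_iff_surjective_up_to_refinements]
    intro A y
    -- Subtracting the lift of `y ≫ b` through `l` leaves an element of `X`, which `p` covers.
    obtain ⟨A₁, π₁, hπ₁, z, hz⟩ := surjective_up_to_refinements_of_epi p' (y ≫ b)
    obtain ⟨x, hx⟩ := h.lift (π₁ ≫ y - z ≫ l) (by simp [hl, hz])
    obtain ⟨A₂, π₂, hπ₂, x', hx'⟩ := surjective_up_to_refinements_of_epi p x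
    refine ⟨A₂, π₂ ≫ π₁, epi_comp _ _, biprod.lift x' (π₂ ≫ z), ?_⟩
    simp only [d, biprod.lift_desc]
    rw [← Category.assoc x', ← hx', Category.assoc π₂ x, hx]
    simp
  obtain ⟨t, ht⟩ := hZ.lift (kernel.ι d ≫ biprod.snd) (by
    rw [Category.assoc, ← hdb, reassoc_of% kernel.condition d, zero_comp])
  have hsz : (k ≫ biprod.inl) ≫ d = 0 := by simp [d, reassoc_of% hX.zero]
  refine ⟨kernel d, kernel.ι d, kernel.lift d (k ≫ biprod.inl) hsz, t, SES.of_epi d,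
    SES.of_lift ?_ ?_ ?_ ?_⟩
  · rw [← cancel_mono k', Category.assoc, ht]
    simp
  · have : Mono (kernel.lift d (k ≫ biprod.inl) hsz ≫ kernel.ι d) := by
      rw [kernel.lift_ι]; exact mono_comp _ _
    exact mono_of_mono _ (kernel.ι d)
  · rw [epi_iff_surjective_up_to_refinements]
    intro A y
    obtain ⟨x, hx⟩ := h.lift (y ≫ k' ≫ l) (by simp [hl, hZ.zero])
    obtain ⟨A₁, π₁, hπ₁, x', hx'⟩ := surjective_up_to_refinements_of_epi p x
    refine ⟨A₁, π₁, hπ₁, kernel.lift d (biprod.lift (-x') (π₁ ≫ y ≫ k')) ?_, ?_⟩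
    · simp only [d, biprod.lift_desc]
      rw [Preadditive.neg_comp, ← Category.assoc x', ← hx', Category.assoc π₁ x, hx]
      simp
    · rw [← cancel_mono k', Category.assoc _ t, ht]
      simp
  · intro W f hf
    have h2 : f ≫ kernel.ι d ≫ biprod.snd = 0 := by rw [← ht, reassoc_of% hf, zero_comp]
    have h1 : (f ≫ kernel.ι d ≫ biprod.fst) ≫ p = 0 := by
      rw [← cancel_mono a]
      have h3 : (f ≫ kernel.ι d) ≫ (biprod.fst ≫ p ≫ a + biprod.snd ≫ l) = 0 := by
        rw [← hd]; simp
      rw [Preadditive.comp_add, Category.assoc f _ (biprod.snd ≫ l), reassoc_of% h2, zero_comp,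
        add_zero] at h3
      simpa using h3
    obtain ⟨g, hg⟩ := hX.lift _ h1
    refine ⟨g, ?_⟩
    rw [← cancel_mono (kernel.ι d)]
    apply biprod.hom_ext
    · simpa using hg
    · simpa using h2.symm

/-- The dual of the horseshoe lemma, for embeddings of the ends into projective objects. -/
theorem cohorseshoe {X Y Z P P' K K' : C} {a : X ⟶ Y} {b : Y ⟶ Z} (h : SES a b)
    {p : X ⟶ P} {k : P ⟶ K} (hX : SES p k) {p' : Z ⟶ P'} {k' : P' ⟶ K'} (hZ : SES p' k')
    (hP : Projective P) (hP' : Projective P') (l : Y ⟶ P) (hl : a ≫ l = p) :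
    ∃ (Q L : C) (i : Y ⟶ Q) (j : Q ⟶ L) (s : K ⟶ L) (t : L ⟶ K'),
      Projective Q ∧ SES i j ∧ SES s t := by
  -- `horseshoe` takes the lift as a hypothesis and needs no projectivity, so it applies in `Cᵒᵖ`.
  -- There `P` and `P'` are injective, and their biproduct goes back to a projective object.
  obtain ⟨L, j, s, t, h₁, h₂⟩ := horseshoe h.op hZ.op hX.op l.op (by rw [← op_comp, hl])
  have : Injective (Opposite.op P) := inferInstance
  have : Injective (Opposite.op P') := inferInstance
  exact ⟨_, L.unop, _, j.unop, t.unop, s.unop, inferInstance, h₁.unop, h₂.unop⟩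

end ShortExactSequences

/-! ### Gorenstein projective objects and finite Gorenstein dimension -/

section GorensteinProjectiveObjects

open Abelian

variable {C : Type*} [Category* C] [Abelian C]

/-- The kernel of a composite of epimorphisms is an extension of the kernel of the second by the
kernel of the first. This serves to replace the first term of a resolution by a projective. -/
theorem SES.kernel_comp {G P K X G' : C} {j : G' ⟶ P} {r : P ⟶ G} (h₁ : SES j r) {i : K ⟶ G}
    {q : G ⟶ X} (h₂ : SES i q) :
    ∃ (L : C) (m : L ⟶ P) (s : G' ⟶ L) (t : L ⟶ K), SES m (r ≫ q) ∧ SES s t := by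
  have := h₁.mono
  have := h₁.epi
  have := h₂.mono
  have := h₂.epi
  have hj : j ≫ r ≫ q = 0 := by simp [reassoc_of% h₁.zero]
  obtain ⟨t, ht⟩ := h₂.lift (kernel.ι (r ≫ q) ≫ r) (by simp)
  refine ⟨kernel (r ≫ q), kernel.ι _, kernel.lift _ j hj, t, SES.of_epi _, SES.of_lift ?_ ?_ ?_ ?_⟩
  · rw [← cancel_mono i, Category.assoc, ht]
    simp [h₁.zero]
  · have : Mono (kernel.lift _ j hj ≫ kernel.ι (r ≫ q)) := by rwa [kernel.lift_ι]
    exact mono_of_mono _ (kernel.ι (r ≫ q))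
  · rw [epi_iff_surjective_up_to_refinements]
    intro A y
    obtain ⟨A₁, π, hπ, x, hx⟩ := surjective_up_to_refinements_of_epi r (y ≫ i)
    refine ⟨A₁, π, hπ, kernel.lift _ x ?_, ?_⟩
    · rw [← reassoc_of% hx, h₂.zero]
      simp
    · rw [← cancel_mono i, Category.assoc _ t, ht]
      simpa using hx
  · intro W f hf
    obtain ⟨g, hg⟩ := h₁.lift (f ≫ kernel.ι _) (by
      rw [Category.assoc, ← ht, reassoc_of% hf, zero_comp])
    exact ⟨g, by rw [← cancel_mono (kernel.ι (r ≫ q))]; simpa using hg⟩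

/-- The vanishing of `Ext¹(X, Y)`: for every short exact sequence `0 → K → P → X → 0`, morphisms
`K ⟶ Y` extend to `P`. -/
def ExtV (X Y : C) : Prop :=
  ∀ ⦃K P : C⦄ (i : K ⟶ P) (q : P ⟶ X), SES i q → ∀ f : K ⟶ Y, ∃ g : P ⟶ Y, i ≫ g = f

theorem extV_of_ext [HasExt.{w} C] {X Y : C} (h : ∀ e : Ext X Y 1, e = 0) : ExtV X Y := by
  intro K P i q ⟨_, hs⟩ f
  obtain ⟨x, hx⟩ := Ext.contravariant_sequence_exact₁ hs Y (Ext.mk₀ f) (add_zero 1) (h _)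
  obtain ⟨g, rfl⟩ := (Ext.mk₀_bijective _ _).2 x
  refine ⟨g, (Ext.mk₀_bijective _ _).1 ?_⟩
  simpa using hx

/-- `Ext¹(X, Y)` may be tested on one presentation of `X`. -/
theorem ext_eq_zero_of_presentation [HasExt.{w} C] {X Y K P : C} [Projective P] {i : K ⟶ P}
    {q : P ⟶ X} (hs : SES i q) (h : ∀ f : K ⟶ Y, ∃ g : P ⟶ Y, i ≫ g = f) (e : Ext X Y 1) :
    e = 0 := by
  obtain ⟨w, hs⟩ := hs
  obtain ⟨x, rfl⟩ := Ext.contravariant_sequence_exact₃ hs Y e (Ext.eq_zero_of_projective _)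
    (add_zero 1)
  obtain ⟨f, rfl⟩ := (Ext.mk₀_bijective _ _).2 x
  obtain ⟨g, rfl⟩ := h f
  rw [← Ext.mk₀_comp_mk₀]
  exact hs.extClass_comp_assoc (Ext.mk₀ g)

theorem exists_lift_of_ext [HasExt.{w} C] {X Y E Z : C} (h : ∀ e : Ext X Y 1, e = 0) {i : Y ⟶ E}
    {q : E ⟶ Z} (hs : SES i q) (f : X ⟶ Z) : ∃ g : X ⟶ E, g ≫ q = f := by
  obtain ⟨w, hs⟩ := hs
  obtain ⟨x, hx⟩ := Ext.covariant_sequence_exact₃ X hs (Ext.mk₀ f) (zero_add 1) (h _)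
  obtain ⟨g, rfl⟩ := (Ext.mk₀_bijective _ _).2 x
  exact ⟨g, (Ext.mk₀_bijective _ _).1 (by simpa using hx)⟩

theorem ext_eq_zero_of_exists_lift [HasExt.{w} C] {X Y E Z : C} [Injective E] {i : Y ⟶ E}
    {q : E ⟶ Z} (hs : SES i q) (h : ∀ f : X ⟶ Z, ∃ g : X ⟶ E, g ≫ q = f) (e : Ext X Y 1) :
    e = 0 := by
  obtain ⟨w, hs⟩ := hs
  obtain ⟨x, rfl⟩ := Ext.covariant_sequence_exact₁ X hs e (Ext.eq_zero_of_injective _)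
    (zero_add 1)
  obtain ⟨f, rfl⟩ := (Ext.mk₀_bijective _ _).2 x
  obtain ⟨g, rfl⟩ := h f
  rw [← Ext.mk₀_comp_mk₀, Ext.comp_assoc_of_second_deg_zero]
  have := hs.comp_extClass
  dsimp only at this
  rw [this, Ext.comp_zero]

theorem exists_presentation [EnoughProjectives C] (X : C) :
    ∃ (K P : C) (i : K ⟶ P) (q : P ⟶ X), Projective P ∧ SES i q :=
  ⟨_, _, _, _, inferInstance, SES.of_epi (Projective.π X)⟩

theorem exists_copresentation [EnoughInjectives C] (X : C) :
    ∃ (E K : C) (i : X ⟶ E) (q : E ⟶ K), Injective E ∧ SES i q :=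
  ⟨_, _, _, _, inferInstance, SES.of_mono (Injective.ι X)⟩

theorem extV_iff [HasExt.{w} C] [EnoughProjectives C] {X Y : C} :
    ExtV X Y ↔ ∀ e : Ext X Y 1, e = 0 := by
  refine ⟨fun h => ?_, extV_of_ext⟩
  obtain ⟨K, P, i, q, hP, hs⟩ := exists_presentation X
  exact ext_eq_zero_of_presentation hs (h i q hs)

/-- Classes of objects closed under the formation of totally acyclic syzygies and cosyzygies. -/
structure IsGClass (𝒢 : C → Prop) : Prop where
  up : ∀ G, 𝒢 G → ∃ (P G' : C) (i : G ⟶ P) (q : P ⟶ G'), Projective P ∧ 𝒢 G' ∧ SES i q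
  down : ∀ G, 𝒢 G → ∃ (P G' : C) (i : G' ⟶ P) (q : P ⟶ G), Projective P ∧ 𝒢 G' ∧ SES i q
  extV : ∀ G, 𝒢 G → ∀ Q : C, Projective Q → ExtV G Q

/-- The Gorenstein projective objects of an abelian category, defined coinductively. -/
def GP (X : C) : Prop := ∃ 𝒢 : C → Prop, IsGClass 𝒢 ∧ 𝒢 X

/-- A union of such classes is again one, so `GP` is the largest. Membership can thus be proved by
exhibiting any class with the three closure properties, without building complete resolutions. -/
theorem isGClass_GP : IsGClass (GP (C := C)) where
  up := by
    rintro G ⟨𝒢, h, hG⟩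
    obtain ⟨P, G', i, q, hP, hG', hs⟩ := h.up G hG
    exact ⟨P, G', i, q, hP, ⟨𝒢, h, hG'⟩, hs⟩
  down := by
    rintro G ⟨𝒢, h, hG⟩
    obtain ⟨P, G', i, q, hP, hG', hs⟩ := h.down G hG
    exact ⟨P, G', i, q, hP, ⟨𝒢, h, hG'⟩, hs⟩
  extV := by
    rintro G ⟨𝒢, h, hG⟩
    exact h.extV G hG

theorem ExtV.of_iso {X X' Y : C} (e : X ≅ X') (h : ExtV X Y) : ExtV X' Y :=
  fun _ _ i q hs => h i (q ≫ e.inv) (hs.comp_iso e.symm)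

theorem GP.of_iso {X X' : C} (e : X ≅ X') (h : GP X) : GP X' := by
  refine ⟨fun Y => ∃ G, GP G ∧ Nonempty (G ≅ Y), ⟨?_, ?_, ?_⟩, X, h, ⟨e⟩⟩
  · rintro Y ⟨G, hG, ⟨e⟩⟩
    obtain ⟨P, G', i, q, hP, hG', hs⟩ := isGClass_GP.up G hG
    exact ⟨P, G', _, q, hP, ⟨G', hG', ⟨Iso.refl _⟩⟩, hs.iso_comp e.symm⟩
  · rintro Y ⟨G, hG, ⟨e⟩⟩
    obtain ⟨P, G', i, q, hP, hG', hs⟩ := isGClass_GP.down G hG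
    exact ⟨P, G', i, _, hP, ⟨G', hG', ⟨Iso.refl _⟩⟩, hs.comp_iso e⟩
  · rintro Y ⟨G, hG, ⟨e⟩⟩ Q hQ
    exact (isGClass_GP.extV G hG Q hQ).of_iso e

theorem SES.id_zero (X : C) : SES (𝟙 X) (0 : X ⟶ (0 : C)) :=
  SES.of_lift (by simp) inferInstance inferInstance fun _ f _ => ⟨f, by simp⟩

theorem SES.zero_id (X : C) : SES (0 : (0 : C) ⟶ X) (𝟙 X) :=
  SES.of_lift (by simp) inferInstance inferInstance fun _ f hf => ⟨0, by simpa using hf.symm⟩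

theorem GP.of_projective {X : C} (hX : Projective X) : GP X := by
  refine ⟨Projective, ⟨?_, ?_, ?_⟩, hX⟩
  · intro G hG
    exact ⟨G, 0, _, _, hG, inferInstance, SES.id_zero G⟩
  · intro G hG
    exact ⟨G, 0, _, _, hG, inferInstance, SES.zero_id G⟩
  · intro G hG Q _
    let := HasExt.standard C
    exact extV_of_ext fun e => Ext.eq_zero_of_projective e

theorem GP.ext_projective [HasExt.{w} C] [EnoughProjectives C] {G Q : C} (hG : GP G)
    (hQ : Projective Q) (k : ℕ) (e : Ext G Q (k + 1)) : e = 0 := by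
  induction k generalizing G with
  | zero => exact extV_iff.1 (isGClass_GP.extV G hG Q hQ) e
  | succ k ih =>
    obtain ⟨P, G', i, q, hP, hG', w, hs⟩ := isGClass_GP.down G hG
    obtain ⟨x, rfl⟩ := Ext.contravariant_sequence_exact₃ hs Q e (Ext.eq_zero_of_projective _)
      (add_comm 1 (k + 1))
    rw [ih hG' x, Ext.comp_zero]

/-- Dimension shifting in the second variable: `Extᵏ⁺¹(G, N)` embeds in `Extᵏ⁺²(G, K)` for a syzygy
`K` of `N`, since `Extᵏ⁺¹(G, P) = 0` for projective `P`. -/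
theorem GP.ext_eq_zero [HasExt.{w} C] [EnoughProjectives C] {G N : C} (hG : GP G) {n : ℕ}
    (hN : HasProjectiveDimensionLT N n) (k : ℕ) (e : Ext G N (k + 1)) : e = 0 := by
  induction n generalizing N k with
  | zero =>
    have hz := isZero_of_hasProjectiveDimensionLT_zero N
    have : (Ext.mk₀ (𝟙 N) : Ext N N 0) = 0 := by rw [hz.eq_of_src (𝟙 N) 0, Ext.mk₀_zero]
    rw [← e.comp_mk₀_id, this, Ext.comp_zero]
  | succ n ih =>
    rcases n with _ | n
    · exact hG.ext_projective (projective_iff_hasProjectiveDimensionLT_one.2 hN) k e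
    obtain ⟨K, P, i, q, hP, w, hs⟩ := exists_presentation N
    have hK := (hs.hasProjectiveDimensionLT_X₃_iff n hP).1 hN
    obtain ⟨x, rfl⟩ := Ext.covariant_sequence_exact₃ G hs e rfl (ih hK (k + 1) _)
    rw [hG.ext_projective hP k x, Ext.zero_comp]

theorem GP.extV [EnoughProjectives C] {G N : C} (hG : GP G) {n : ℕ}
    (hN : HasProjectiveDimensionLT N n) : ExtV G N := by
  let := HasExt.standard C
  exact extV_of_ext fun e => hG.ext_eq_zero hN 0 e

/-- Objects with an infinite projective coresolution have no extensions by objects of finite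
injective dimension. -/
theorem ext_eq_zero_of_up [HasExt.{w} C] {𝒢 : C → Prop}
    (h : ∀ G, 𝒢 G → ∃ (P G' : C) (i : G ⟶ P) (q : P ⟶ G'), Projective P ∧ 𝒢 G' ∧ SES i q)
    {G N : C} (hG : 𝒢 G) (m k : ℕ) (hN : HasInjectiveDimensionLT N (m + k + 1))
    (e : Ext G N (k + 1)) : e = 0 := by
  induction m generalizing G k with
  | zero => exact Ext.eq_zero_of_hasInjectiveDimensionLT e (0 + k + 1) (by lia)
  | succ m ih =>
    obtain ⟨P, G', i, q, hP, hG', w, hs⟩ := h G hG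
    -- A step along the coresolution trades degree `k + 1` at `G` for degree `k + 2` at `G'`. After
    -- `m` steps the degree reaches the bound on the injective dimension.
    have h0 := ih hG' (k + 1) (by rwa [add_right_comm m 1 k] at hN)
    obtain ⟨x, rfl⟩ := Ext.contravariant_sequence_exact₁ hs N e (add_comm 1 (k + 1)) (h0 _)
    rw [Ext.eq_zero_of_projective x, Ext.comp_zero]

theorem extV_of_up {𝒢 : C → Prop}
    (h : ∀ G, 𝒢 G → ∃ (P G' : C) (i : G ⟶ P) (q : P ⟶ G'), Projective P ∧ 𝒢 G' ∧ SES i q)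
    {G N : C} (hG : 𝒢 G) (m : ℕ) (hN : HasInjectiveDimensionLT N m) : ExtV G N := by
  let := HasExt.standard C
  exact extV_of_ext fun e => ext_eq_zero_of_up h hG m 0 (hasInjectiveDimensionLT_of_ge N m _
    (by lia)) e

/-- Extensions of Gorenstein projectives form a class as in `IsGClass`, by the two horseshoe lemmas.
The lift needed for the dual one, extending `X ⟶ P` to `Y`, exists because `Ext¹(Z, P) = 0`. -/
theorem GP.extension [EnoughProjectives C] {X Y Z : C} {a : X ⟶ Y} {b : Y ⟶ Z} (h : SES a b)
    (hX : GP X) (hZ : GP Z) : GP Y := by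
  refine ⟨fun Y => ∃ (X Z : C) (a : X ⟶ Y) (b : Y ⟶ Z), GP X ∧ GP Z ∧ SES a b, ⟨?_, ?_, ?_⟩,
    X, Z, a, b, hX, hZ, h⟩
  · rintro Y ⟨X, Z, a, b, hX, hZ, h⟩
    obtain ⟨P, X', i, q, hP, hX', hs⟩ := isGClass_GP.up X hX
    obtain ⟨P', Z', i', q', hP', hZ', hs'⟩ := isGClass_GP.up Z hZ
    obtain ⟨l, hl⟩ := isGClass_GP.extV Z hZ P hP a b h i
    obtain ⟨Q, L, m, j, s, t, hQ, h₁, h₂⟩ := cohorseshoe h hs hs' hP hP' l hl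
    exact ⟨Q, L, m, j, hQ, ⟨X', Z', s, t, hX', hZ', h₂⟩, h₁⟩
  · rintro Y ⟨X, Z, a, b, hX, hZ, h⟩
    obtain ⟨P, X', i, q, hP, hX', hs⟩ := isGClass_GP.down X hX
    obtain ⟨P', Z', i', q', hP', hZ', hs'⟩ := isGClass_GP.down Z hZ
    have := h.epi
    obtain ⟨L, j, s, t, h₁, h₂⟩ := horseshoe h hs hs' (Projective.factorThru q' b) (by simp)
    exact ⟨_, L, j, _, inferInstance, ⟨X', Z', s, t, hX', hZ', h₂⟩, h₁⟩
  · rintro Y ⟨X, Z, a, b, hX, hZ, w, h⟩ Q hQ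
    let := HasExt.standard C
    refine extV_of_ext fun e => ?_
    obtain ⟨x, rfl⟩ := Ext.contravariant_sequence_exact₂ h Q e (hX.ext_projective hQ 0 _)
    rw [hZ.ext_projective hQ 0 x, Ext.comp_zero]

/-- `FinRes 𝒳 n X`: there is an exact sequence `0 → X n → ⋯ → X 0 → X → 0` with terms in `𝒳`. -/
def FinRes (𝒳 : C → Prop) : ℕ → C → Prop
  | 0, X => 𝒳 X
  | n + 1, X => ∃ (G K : C) (i : K ⟶ G) (q : G ⟶ X), 𝒳 G ∧ FinRes 𝒳 n K ∧ SES i q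

/-- Objects of finite Gorenstein projective dimension. -/
def FG (X : C) : Prop := ∃ n, FinRes GP n X

/-- There is an exact sequence `0 → G → P (n - 1) → ⋯ → P 0 → X → 0` with `G` Gorenstein projective
and all `P i` projective. -/
def GPSyzygy : ℕ → C → Prop
  | 0, X => GP X
  | n + 1, X => ∃ (P K : C) (i : K ⟶ P) (q : P ⟶ X), Projective P ∧ GPSyzygy n K ∧ SES i q

theorem GPSyzygy.succ {n : ℕ} {X : C} (h : GPSyzygy n X) : GPSyzygy (n + 1) X := by
  induction n generalizing X with
  | zero => exact isGClass_GP.down X h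
  | succ n ih =>
    obtain ⟨P, K, i, q, hP, hK, hs⟩ := h
    exact ⟨P, K, i, q, hP, ih hK, hs⟩

theorem GPSyzygy.le {m n : ℕ} (hmn : m ≤ n) {X : C} (h : GPSyzygy m X) : GPSyzygy n X :=
  Nat.le_induction h (fun _ _ ih => ih.succ) n hmn

theorem GPSyzygy.extension [EnoughProjectives C] {n : ℕ} {X Y Z : C} {a : X ⟶ Y} {b : Y ⟶ Z}
    (h : SES a b) (hX : GPSyzygy n X) (hZ : GPSyzygy n Z) : GPSyzygy n Y := by
  induction n generalizing X Y Z with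
  | zero => exact GP.extension h hX hZ
  | succ n ih =>
    obtain ⟨P, K, i, q, hP, hK, hs⟩ := hX
    obtain ⟨P', K', i', q', hP', hK', hs'⟩ := hZ
    have := h.epi
    obtain ⟨L, j, s, t, h₁, h₂⟩ := horseshoe h hs hs' (Projective.factorThru q' b) (by simp)
    exact ⟨_, L, j, _, inferInstance, ih h₂ hK hK', h₁⟩

/-- Cover the first term `G` by a projective `P` with Gorenstein projective kernel `G'`. The kernel
of `P ⟶ X` is then an extension of `K` by `G'`. Resolutions that are projective up to the last term
are the ones to which the horseshoe lemma applies. -/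
theorem FinRes.gpSyzygy [EnoughProjectives C] {n : ℕ} {X : C} (h : FinRes GP n X) :
    GPSyzygy n X := by
  induction n generalizing X with
  | zero => exact h
  | succ n ih =>
    obtain ⟨G, K, i, q, hG, hK, hs⟩ := h
    obtain ⟨P, G', j, r, hP, hG', hs'⟩ := isGClass_GP.down G hG
    obtain ⟨L, m, s, t, h₁, h₂⟩ := hs'.kernel_comp hs
    exact ⟨P, L, m, _, hP, GPSyzygy.extension h₂ (GPSyzygy.le (m := 0) n.zero_le hG') (ih hK), h₁⟩

theorem GPSyzygy.finRes {n : ℕ} {X : C} (h : GPSyzygy n X) : FinRes GP n X := by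
  induction n generalizing X with
  | zero => exact h
  | succ n ih =>
    obtain ⟨P, K, i, q, hP, hK, hs⟩ := h
    exact ⟨P, K, i, q, GP.of_projective hP, ih hK, hs⟩

theorem fg_iff [EnoughProjectives C] {X : C} : FG X ↔ ∃ n, GPSyzygy n X :=
  exists_congr fun _ => ⟨FinRes.gpSyzygy, GPSyzygy.finRes⟩

theorem GP.fg {X : C} (h : GP X) : FG X := ⟨0, h⟩

theorem FG.extension [EnoughProjectives C] {X Y Z : C} {a : X ⟶ Y} {b : Y ⟶ Z} (h : SES a b)
    (hX : FG X) (hZ : FG Z) : FG Y := by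
  rw [fg_iff] at *
  obtain ⟨m, hX⟩ := hX
  obtain ⟨n, hZ⟩ := hZ
  exact ⟨max m n, GPSyzygy.extension h (hX.le (le_max_left _ _)) (hZ.le (le_max_right _ _))⟩

/-- For a projective `P` covering `Y` with kernel `K`, the kernel of `P ⟶ Z` is an extension of `X`
by `K`. -/
theorem FG.cokernel [EnoughProjectives C] {X Y Z : C} {a : X ⟶ Y} {b : Y ⟶ Z} (h : SES a b)
    (hX : FG X) (hY : FG Y) : FG Z := by
  rw [fg_iff] at *
  obtain ⟨m, hX⟩ := hX
  obtain ⟨n, hY⟩ := hY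
  obtain ⟨P, K, i, q, hP, hK, hs⟩ := hY.succ
  obtain ⟨L, j, s, t, h₁, h₂⟩ := hs.kernel_comp h
  exact ⟨max m n + 1, P, L, j, _, hP,
    GPSyzygy.extension h₂ (hK.le (le_max_right _ _)) (hX.le (le_max_left _ _)), h₁⟩

theorem FinRes.of_iso {𝒳 : C → Prop} (h𝒳 : ∀ {X X' : C}, (X ≅ X') → 𝒳 X → 𝒳 X') {n : ℕ} {X X' : C}
    (e : X ≅ X') (h : FinRes 𝒳 n X) : FinRes 𝒳 n X' := by
  cases n with
  | zero => exact h𝒳 e h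
  | succ n =>
    obtain ⟨G, K, i, q, hG, hK, hs⟩ := h
    exact ⟨G, K, i, _, hG, hK, hs.comp_iso e⟩

theorem FG.of_iso {X X' : C} (e : X ≅ X') (h : FG X) : FG X' :=
  h.imp fun _ h => h.of_iso GP.of_iso e

theorem FG.of_finRes [EnoughProjectives C] {n : ℕ} {X : C} (h : FinRes FG n X) : FG X := by
  induction n generalizing X with
  | zero => exact h
  | succ n ih =>
    obtain ⟨G, K, i, q, hG, hK, hs⟩ := h
    exact FG.cokernel hs (ih hK) hG

theorem FinRes.map {D : Type*} [Category* D] [Abelian D] (F : C ⥤ D) [PreservesFiniteLimits F]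
    [PreservesFiniteColimits F] {𝒳 : C → Prop} {𝒴 : D → Prop} (hF : ∀ X, 𝒳 X → 𝒴 (F.obj X))
    {n : ℕ} {X : C} (h : FinRes 𝒳 n X) : FinRes 𝒴 n (F.obj X) := by
  induction n generalizing X with
  | zero => exact hF X h
  | succ n ih =>
    obtain ⟨G, K, i, q, hG, hK, hs⟩ := h
    exact ⟨_, _, _, _, hF G hG, ih hK, hs.map F⟩

/-- `K` is an `n`-th syzygy of `X`. -/
def Syz : ℕ → C → C → Prop
  | 0, K, X => Nonempty (K ≅ X)
  | n + 1, K, X => ∃ (X' P : C) (i : X' ⟶ P) (q : P ⟶ X), Projective P ∧ SES i q ∧ Syz n K X'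

theorem exists_syz [EnoughProjectives C] (n : ℕ) (X : C) : ∃ K, Syz n K X := by
  induction n generalizing X with
  | zero => exact ⟨X, ⟨Iso.refl _⟩⟩
  | succ n ih =>
    obtain ⟨X', P, i, q, hP, hs⟩ := exists_presentation X
    obtain ⟨K, hK⟩ := ih X'
    exact ⟨K, X', P, i, q, hP, hs, hK⟩

/-- `Syz` unfolds at the end near `X`; this adds a step at the other end. -/
theorem Syz.succ {n : ℕ} {X K K' P : C} (h : Syz n K X) {i : K' ⟶ P} {q : P ⟶ K}
    (hP : Projective P) (hs : SES i q) : Syz (n + 1) K' X := by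
  induction n generalizing X with
  | zero =>
    obtain ⟨e⟩ := h
    exact ⟨K', P, i, _, hP, hs.comp_iso e, ⟨Iso.refl _⟩⟩
  | succ n ih =>
    obtain ⟨X', Q, j, r, hQ, hs', h⟩ := h
    exact ⟨X', Q, j, r, hQ, hs', ih h⟩

theorem Syz.horseshoe {n : ℕ} {X Y Z K K' : C} {a : X ⟶ Y} {b : Y ⟶ Z} (h : SES a b)
    (hX : Syz n K X) (hZ : Syz n K' Z) :
    ∃ (L : C) (s : K ⟶ L) (t : L ⟶ K'), Syz n L Y ∧ SES s t := by
  induction n generalizing X Y Z with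
  | zero =>
    obtain ⟨e⟩ := hX
    obtain ⟨e'⟩ := hZ
    exact ⟨Y, _, _, ⟨Iso.refl _⟩, (h.iso_comp e).comp_iso e'.symm⟩
  | succ n ih =>
    obtain ⟨X', P, i, q, hP, hs, hX⟩ := hX
    obtain ⟨Z', P', i', q', hP', hs', hZ⟩ := hZ
    have := h.epi
    obtain ⟨L, j, s, t, h₁, h₂⟩ :=
      TriangularGorenstein.horseshoe h hs hs' (Projective.factorThru q' b) (by simp)
    obtain ⟨M, s', t', hM, hs''⟩ := ih h₂ hX hZ
    exact ⟨M, s', t', ⟨L, _, j, _, inferInstance, h₁, hM⟩, hs''⟩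

theorem Syz.projective {n : ℕ} {X K : C} (h : Syz n K X)
    (hX : HasProjectiveDimensionLT X (n + 1)) : Projective K := by
  induction n generalizing X with
  | zero =>
    obtain ⟨e⟩ := h
    rw [projective_iff_hasProjectiveDimensionLT_one]
    exact hasProjectiveDimensionLT_of_iso e.symm _
  | succ n ih =>
    obtain ⟨X', P, i, q, hP, ⟨w, hs⟩, h⟩ := h
    exact ih h ((hs.hasProjectiveDimensionLT_X₃_iff n hP).1 hX)

theorem Syz.gpSyzygy {n : ℕ} {X K : C} (h : Syz n K X) (hK : GP K) : GPSyzygy n X := by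
  induction n generalizing X with
  | zero =>
    obtain ⟨e⟩ := h
    exact hK.of_iso e
  | succ n ih =>
    obtain ⟨X', P, i, q, hP, hs, h⟩ := h
    exact ⟨P, X', i, q, hP, ih h, hs⟩

/-- If injective objects have uniformly bounded projective dimension and projective objects have
finite injective dimension, then all Gorenstein projective dimensions are finite. -/
theorem FG.of_bounded [EnoughProjectives C] [EnoughInjectives C] (n : ℕ)
    (hI : ∀ E : C, Injective E → HasProjectiveDimensionLT E (n + 1))
    (hP : ∀ Q : C, Projective Q → ∃ m, HasInjectiveDimensionLT Q m) (X : C) : FG X := by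
  have hup : ∀ K : C, (∃ X, Syz n K X) → ∃ (P G' : C) (i : K ⟶ P) (q : P ⟶ G'),
      Projective P ∧ (∃ X, Syz n G' X) ∧ SES i q := by
    rintro K ⟨X, hK⟩
    -- Apply `n`-th syzygies to `0 → X → E → Z → 0` with `E` injective. The middle syzygy `L` is
    -- projective because `E` has projective dimension at most `n`, so `K` embeds in a projective
    -- with cokernel an `n`-th syzygy.
    obtain ⟨E, Z, a, b, hE, hs⟩ := exists_copresentation X
    obtain ⟨K', hK'⟩ := exists_syz n Z
    obtain ⟨L, s, t, hL, hs'⟩ := Syz.horseshoe hs hK hK'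
    exact ⟨L, K', s, t, hL.projective (hI E hE), ⟨Z, hK'⟩, hs'⟩
  have hcl : IsGClass fun K : C => ∃ X, Syz n K X := by
    refine ⟨hup, ?_, ?_⟩
    · rintro K ⟨X, hK⟩
      obtain ⟨K', P, i, q, hP, hs⟩ := exists_presentation K
      -- An `(n + 1)`-st syzygy of `X` is an `n`-th syzygy of a first syzygy of `X`.
      obtain ⟨X', _, _, _, _, _, h⟩ := hK.succ hP hs
      exact ⟨P, K', i, q, hP, ⟨X', h⟩, hs⟩
    · intro K hK Q hQ
      obtain ⟨m, hm⟩ := hP Q hQ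
      exact extV_of_up hup hK m hm
  obtain ⟨K, hK⟩ := exists_syz n X
  exact fg_iff.2 ⟨n, hK.gpSyzygy ⟨_, hcl, X, hK⟩⟩

/-- A left adjoint preserves Gorenstein projectives if it preserves projectives and short exact
sequences of Gorenstein projectives, and the right adjoint carries projectives to objects of
finite projective dimension. -/
theorem GP.map {D : Type*} [Category* D] [Abelian D] [EnoughProjectives C] {F : C ⥤ D} {R : D ⥤ C}
    (adj : F ⊣ R) (hproj : ∀ P : C, Projective P → Projective (F.obj P))
    (hmono : ∀ {K P G : C} (i : K ⟶ P) (q : P ⟶ G), SES i q → Projective P → GP G →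
      Mono (F.map i))
    (hR : ∀ Q : D, Projective Q → ∃ n, HasProjectiveDimensionLT (R.obj Q) n)
    {X : C} (hX : GP X) : GP (F.obj X) := by
  have := adj.isLeftAdjoint
  -- The class is the image of the Gorenstein projectives. By adjunction, extending `F K ⟶ Q` to `F
  -- P` amounts to extending `K ⟶ R Q` to `P`, which `Ext¹(G, R Q) = 0` permits.
  refine ⟨fun Y => ∃ G : C, GP G ∧ F.obj G = Y, ⟨?_, ?_, ?_⟩, X, hX, rfl⟩
  · rintro _ ⟨G, hG, rfl⟩
    obtain ⟨P, G', i, q, hP, hG', hs⟩ := isGClass_GP.up G hG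
    exact ⟨F.obj P, F.obj G', F.map i, F.map q, hproj P hP, ⟨G', hG', rfl⟩,
      hs.map_of_mono F (hmono i q hs hP hG')⟩
  · rintro _ ⟨G, hG, rfl⟩
    obtain ⟨P, G', i, q, hP, hG', hs⟩ := isGClass_GP.down G hG
    exact ⟨F.obj P, F.obj G', F.map i, F.map q, hproj P hP, ⟨G', hG', rfl⟩,
      hs.map_of_mono F (hmono i q hs hP hG)⟩
  · rintro _ ⟨G, hG, rfl⟩ Q hQ
    obtain ⟨P, G', i, q, hP, hG', hs⟩ := isGClass_GP.down G hG
    obtain ⟨n, hn⟩ := hR Q hQ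
    let := HasExt.standard D
    have := hproj P hP
    refine extV_of_ext (ext_eq_zero_of_presentation (hs.map_of_mono F (hmono i q hs hP hG))
      fun f => ?_)
    obtain ⟨g, hg⟩ := hG.extV hn i q hs (adj.homEquiv _ _ f)
    refine ⟨(adj.homEquiv _ _).symm g, ?_⟩
    rw [← Adjunction.homEquiv_naturality_left_symm, hg, Equiv.symm_apply_apply]

end GorensteinProjectiveObjects

/-! ### Comparing homological dimensions; passage to the opposite category -/

section HomologicalDimensions

open Abelian

variable {C : Type*} [Category* C] [Abelian C]

/-- Since `Extᵏ⁺²(-, N)` is `Extᵏ⁺¹(-, N')` for the cokernel `N'` of an embedding of `N` in an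
injective, an implication between vanishing of `Ext¹` for all `N` propagates to every higher degree.
-/
theorem hasProjectiveDimensionLT_of_extV [EnoughProjectives C] [EnoughInjectives C]
    {U V : C} (h : ∀ N, ExtV U N → ExtV V N) {n : ℕ}
    (hU : HasProjectiveDimensionLT U (n + 1)) : HasProjectiveDimensionLT V (n + 1) := by
  let := HasExt.standard C
  have key : ∀ (k : ℕ) (N : C), (∀ e : Ext U N (k + 1), e = 0) → ∀ e : Ext V N (k + 1), e = 0 := by
    intro k
    induction k with
    | zero => exact fun N hN => extV_iff.1 (h N (extV_of_ext hN))
    | succ k ih =>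
      intro N hN e
      obtain ⟨E, N', i, q, hE, w, hs⟩ := exists_copresentation N
      have hN' : ∀ e : Ext U N' (k + 1), e = 0 := fun e => by
        obtain ⟨x, rfl⟩ := Ext.covariant_sequence_exact₃ U hs e rfl (hN _)
        rw [Ext.eq_zero_of_injective x, Ext.zero_comp]
      obtain ⟨x, rfl⟩ := Ext.covariant_sequence_exact₁ V hs e (Ext.eq_zero_of_injective _) rfl
      rw [ih N' hN' x, Ext.zero_comp]
  exact hasProjectiveDimensionLT_of_enoughInjectives V _ fun N => ⟨fun a b => by
    have h0 := key n N fun e => Ext.eq_zero_of_hasProjectiveDimensionLT e (n + 1) le_rfl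
    rw [h0 a, h0 b]⟩

theorem hasInjectiveDimensionLT_of_extV [EnoughProjectives C] {U V : C}
    (h : ∀ X, ExtV X U → ExtV X V) {n : ℕ}
    (hU : HasInjectiveDimensionLT U (n + 1)) : HasInjectiveDimensionLT V (n + 1) := by
  let := HasExt.standard C
  have key : ∀ (k : ℕ) (X : C), (∀ e : Ext X U (k + 1), e = 0) → ∀ e : Ext X V (k + 1), e = 0 := by
    intro k
    induction k with
    | zero => exact fun X hX => extV_iff.1 (h X (extV_of_ext hX))
    | succ k ih =>
      intro X hX e
      obtain ⟨X', P, i, q, hP, w, hs⟩ := exists_presentation X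
      have hX' : ∀ e : Ext X' U (k + 1), e = 0 := fun e => by
        obtain ⟨x, rfl⟩ := Ext.contravariant_sequence_exact₁ hs U e (add_comm 1 (k + 1)) (hX _)
        rw [Ext.eq_zero_of_projective x, Ext.comp_zero]
      obtain ⟨x, rfl⟩ := Ext.contravariant_sequence_exact₃ hs V e (Ext.eq_zero_of_projective _)
        (add_comm 1 (k + 1))
      rw [ih X' hX' x, Ext.comp_zero]
  exact hasInjectiveDimensionLT_of_enoughProjectives V _ fun N => ⟨fun a b => by
    have h0 := key n N fun e => Ext.eq_zero_of_hasInjectiveDimensionLT e (n + 1) le_rfl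
    rw [h0 a, h0 b]⟩

theorem hasInjectiveDimensionLT_op [EnoughProjectives C] {n : ℕ} {X : C}
    (h : HasProjectiveDimensionLT X n) :
    HasInjectiveDimensionLT (Opposite.op X) n := by
  induction n generalizing X with
  | zero => exact (isZero_of_hasProjectiveDimensionLT_zero X).op.hasInjectiveDimensionLT_zero
  | succ n ih =>
    rcases n with _ | n
    · have := projective_iff_hasProjectiveDimensionLT_one.2 h
      exact injective_iff_hasInjectiveDimensionLT_one.1 inferInstance
    · obtain ⟨K, P, i, q, hP, hs⟩ := exists_presentation X
      obtain ⟨w', hs'⟩ := hs.op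
      obtain ⟨w, hs⟩ := hs
      exact (hs'.hasInjectiveDimensionLT_X₃_iff n (inferInstanceAs (Injective (Opposite.op P)))).1
        (ih ((hs.hasProjectiveDimensionLT_X₃_iff n hP).1 h))

theorem hasProjectiveDimensionLT_op [EnoughInjectives C] {n : ℕ} {X : C}
    (h : HasInjectiveDimensionLT X n) :
    HasProjectiveDimensionLT (Opposite.op X) n := by
  induction n generalizing X with
  | zero => exact (isZero_of_hasInjectiveDimensionLT_zero X).op.hasProjectiveDimensionLT_zero
  | succ n ih =>
    rcases n with _ | n
    · have := injective_iff_hasInjectiveDimensionLT_one.2 h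
      exact projective_iff_hasProjectiveDimensionLT_one.1 inferInstance
    · obtain ⟨E, K, i, q, hE, hs⟩ := exists_copresentation X
      obtain ⟨w', hs'⟩ := hs.op
      obtain ⟨w, hs⟩ := hs
      exact (hs'.hasProjectiveDimensionLT_X₃_iff n (inferInstanceAs (Projective (Opposite.op E)))).2
        (ih ((hs.hasInjectiveDimensionLT_X₃_iff n hE).2 h))

theorem hasProjectiveDimensionLT_map [EnoughProjectives C] {D : Type*} [Category* D] [Abelian D]
    (F : C ⥤ D) [PreservesFiniteLimits F] [PreservesFiniteColimits F]
    (hF : ∀ P, Projective P → Projective (F.obj P)) {n : ℕ} {X : C}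
    (h : HasProjectiveDimensionLT X n) : HasProjectiveDimensionLT (F.obj X) n := by
  have := F.preservesZeroMorphisms_of_preserves_terminal_object
  induction n generalizing X with
  | zero =>
    exact (F.map_isZero (isZero_of_hasProjectiveDimensionLT_zero X)).hasProjectiveDimensionLT_zero
  | succ n ih =>
    rcases n with _ | n
    · exact projective_iff_hasProjectiveDimensionLT_one.1
        (hF X (projective_iff_hasProjectiveDimensionLT_one.2 h))
    · obtain ⟨K, P, i, q, hP, hs⟩ := exists_presentation X
      obtain ⟨w', hs'⟩ := hs.map F
      obtain ⟨w, hs⟩ := hs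
      exact (hs'.hasProjectiveDimensionLT_X₃_iff n (hF P hP)).2
        (ih ((hs.hasProjectiveDimensionLT_X₃_iff n hP).1 h))

end HomologicalDimensions

/-! ### Gorenstein dimensions under gluing -/

section Gluing

variable {𝒜 ℬ 𝒯 : Type*} [Category* 𝒜] [Category* ℬ] [Category* 𝒯] [Abelian 𝒜] [Abelian ℬ]
  [Abelian 𝒯]

/-- Finiteness of Gorenstein projective dimensions in an abelian category `𝒯` glued from `𝒜` and
`ℬ` along exact sequences `0 → i₂ (e₂ M) → M → i₁ (e₁ M) → 0`. -/
theorem fg_iff_of_gluing [EnoughProjectives 𝒜] [EnoughProjectives ℬ] [EnoughProjectives 𝒯]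
    {e₁ : 𝒯 ⥤ 𝒜} {e₂ : 𝒯 ⥤ ℬ} {i₁ : 𝒜 ⥤ 𝒯} {i₂ : ℬ ⥤ 𝒯} {p : 𝒜 ⥤ 𝒯}
    (adjp : p ⊣ e₁) (adj₁ : e₁ ⊣ i₁) (adj₂ : i₂ ⊣ e₂)
    [PreservesFiniteColimits e₂] [PreservesFiniteColimits i₁] [PreservesFiniteLimits i₂]
    (hseq : ∀ M, ∃ (f : i₂.obj (e₂.obj M) ⟶ M) (g : M ⟶ i₁.obj (e₁.obj M)), SES f g)
    (hp : ∀ X, Nonempty (e₁.obj (p.obj X) ≅ X))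
    (hmono : ∀ {K P G : 𝒜} (i : K ⟶ P) (q : P ⟶ G), SES i q → Projective P → GP G →
      Mono (p.map i))
    (hpd : ∀ Q : 𝒯, Projective Q → ∃ n, HasProjectiveDimensionLT (e₂.obj Q) n)
    (hℬ : ∀ Y : ℬ, FG Y) (M : 𝒯) : FG M ↔ FG (e₁.obj M) := by
  have := adjp.isRightAdjoint
  have := adj₁.isRightAdjoint
  have := adj₁.isLeftAdjoint
  have := adj₂.isRightAdjoint
  have := adj₂.isLeftAdjoint
  have : e₂.Additive := by
    have := preservesBinaryBiproducts_of_preservesBinaryCoproducts e₂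
    exact Functor.additive_of_preservesBinaryBiproducts e₂
  have : i₁.Additive := by
    have := preservesBinaryBiproducts_of_preservesBinaryCoproducts i₁
    exact Functor.additive_of_preservesBinaryBiproducts i₁
  have : PreservesFiniteLimits e₁ := inferInstance
  have : PreservesFiniteColimits e₁ := inferInstance
  have hp_proj : ∀ P, Projective P → Projective (p.obj P) := fun P hP => adjp.map_projective P hP
  have he₁_proj : ∀ P, Projective P → Projective (e₁.obj P) := fun P hP => adj₁.map_projective P hP
  have hi₂_proj : ∀ P, Projective P → Projective (i₂.obj P) := fun P hP => adj₂.map_projective P hP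
  have hi₁_pd : ∀ Q : 𝒜, Projective Q → ∃ n, HasProjectiveDimensionLT (i₁.obj Q) n := by
    intro Q hQ
    obtain ⟨e⟩ := hp Q
    -- `i₁ Q` is the cokernel of `i₂ (e₂ (p Q)) ⟶ p Q`, with `p Q` projective and `e₂ (p Q)` of
    -- finite projective dimension.
    obtain ⟨f, g, w, hs⟩ := hseq (p.obj Q)
    obtain ⟨n, hn⟩ := hpd _ (hp_proj Q hQ)
    have := hp_proj Q hQ
    have h3 := hs.hasProjectiveDimensionLT_X₃ n (hasProjectiveDimensionLT_map i₂ hi₂_proj hn)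
      (hasProjectiveDimensionLT_of_ge _ 1 _ (by lia))
    exact ⟨n + 1, hasProjectiveDimensionLT_of_iso (i₁.mapIso e) _⟩
  have he₁ : ∀ G, GP G → GP (e₁.obj G) := fun G hG => GP.map adj₁ he₁_proj
    (fun i q hs _ _ => (hs.map e₁).mono) hi₁_pd hG
  have hi₂ : ∀ G, GP G → GP (i₂.obj G) := fun G hG => GP.map adj₂ hi₂_proj
    (fun i q hs _ _ => (hs.map i₂).mono) hpd hG
  have hp_gp : ∀ G, GP G → GP (p.obj G) := fun G hG => GP.map adjp hp_proj hmono
    (fun Q hQ => ⟨1, projective_iff_hasProjectiveDimensionLT_one.1 (he₁_proj Q hQ)⟩) hG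
  have hi₂_fg : ∀ Y, FG (i₂.obj Y) := fun Y => (hℬ Y).imp fun n h => h.map i₂ hi₂
  have hi₁ : ∀ G, GP G → FG (i₁.obj G) := by
    intro G hG
    obtain ⟨e⟩ := hp G
    obtain ⟨f, g, hs⟩ := hseq (p.obj G)
    -- `i₁` need not preserve Gorenstein projectives, but the sequence of `p G` bounds the
    -- Gorenstein dimension of `i₁ G`.
    exact (FG.cokernel hs (hi₂_fg _) (hp_gp G hG).fg).of_iso (i₁.mapIso e)
  refine ⟨fun ⟨n, h⟩ => ⟨n, h.map e₁ he₁⟩, fun ⟨n, h⟩ => ?_⟩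
  obtain ⟨f, g, hs⟩ := hseq M
  exact FG.extension hs (hi₂_fg _) (FG.of_finRes (h.map i₁ hi₁))

/-- The dual of `fg_iff_of_gluing`. -/
theorem fg_op_iff_of_gluing [EnoughInjectives 𝒜] [EnoughInjectives ℬ] [EnoughInjectives 𝒯]
    {e₁ : 𝒯 ⥤ 𝒜} {e₂ : 𝒯 ⥤ ℬ} {i₁ : 𝒜 ⥤ 𝒯} {i₂ : ℬ ⥤ 𝒯} {h : ℬ ⥤ 𝒯}
    (adjh : e₂ ⊣ h) (adj₁ : e₁ ⊣ i₁) (adj₂ : i₂ ⊣ e₂)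
    [PreservesFiniteLimits e₁] [PreservesFiniteColimits i₁] [PreservesFiniteLimits i₂]
    (hseq : ∀ M, ∃ (f : i₂.obj (e₂.obj M) ⟶ M) (g : M ⟶ i₁.obj (e₁.obj M)), SES f g)
    (hh : ∀ Y, Nonempty (e₂.obj (h.obj Y) ≅ Y))
    (hepi : ∀ {G E K : ℬ} (i : G ⟶ E) (q : E ⟶ K), SES i q → Injective E → GP (Opposite.op G) →
      Epi (h.map q))
    (hid : ∀ E : 𝒯, Injective E → ∃ n, HasInjectiveDimensionLT (e₁.obj E) n)
    (h𝒜 : ∀ X : 𝒜, FG (Opposite.op X)) (M : 𝒯) :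
    FG (Opposite.op M) ↔ FG (Opposite.op (e₂.obj M)) := by
  have := preservesFiniteColimits_op e₁
  have := preservesFiniteLimits_op i₁
  have := preservesFiniteColimits_op i₂
  -- Opposites turn the subobject `i₂ (e₂ M)` into the quotient, so the indices `1` and `2` are
  -- exchanged.
  refine fg_iff_of_gluing (e₁ := e₂.op) (e₂ := e₁.op) (i₁ := i₂.op) (i₂ := i₁.op) (p := h.op)
    adjh.op adj₂.op adj₁.op ?_ ?_ ?_ ?_ (fun Y => h𝒜 Y.unop) (Opposite.op M)
  · intro M
    obtain ⟨f, g, hs⟩ := hseq M.unop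
    exact ⟨g.op, f.op, hs.op⟩
  · intro Y
    obtain ⟨e⟩ := hh Y.unop
    exact ⟨e.symm.op⟩
  · intro K P G i q hs hP hG
    have := hepi q.unop i.unop hs.unop inferInstance hG
    exact inferInstanceAs (Mono (h.map i.unop).op)
  · intro Q hQ
    obtain ⟨n, hn⟩ := hid Q.unop inferInstance
    exact ⟨n, hasProjectiveDimensionLT_op hn⟩

end Gluing

/-! ### From the coinductive definition to two-sided sequences -/

section CompleteResolutions

theorem exists_int_path {α : Type*} (r : α → α → Prop) (h₁ : ∀ x, ∃ y, r x y)
    (h₂ : ∀ x, ∃ y, r y x) (x : α) : ∃ s : ℤ → α, s 0 = x ∧ ∀ n, r (s n) (s (n + 1)) := by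
  choose f hf using h₁
  choose g hg using h₂
  -- `Int.negSucc k` stands for `-(k + 1)`, hence `k + 1` predecessors.
  refine ⟨fun n => Int.rec (fun k => f^[k] x) (fun k => g^[k + 1] x) n, rfl, ?_⟩
  rintro (k | _ | k)
  · change r (f^[k] x) (f^[k + 1] x)
    rw [Function.iterate_succ_apply']
    exact hf _
  · exact hg x
  · change r (g^[k + 2] x) (g^[k + 1] x)
    rw [Function.iterate_succ_apply']
    exact hg _

variable {C : Type*} [Category* C] [Abelian C]

theorem GP.exists_sequence {X : C} (hX : GP X) :
    ∃ (G P : ℤ → C) (i : ∀ n, G n ⟶ P n) (q : ∀ n, P n ⟶ G (n + 1)),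
      G 0 = X ∧ (∀ n, GP (G n)) ∧ (∀ n, Projective (P n)) ∧ ∀ n, SES (i n) (q n) := by
  obtain ⟨s, h0, hs⟩ := exists_int_path (α := { G : C // GP G })
    (fun G G' => ∃ (P : C) (i : G.1 ⟶ P) (q : P ⟶ G'.1), Projective P ∧ SES i q)
    (fun ⟨G, hG⟩ => by
      obtain ⟨P, G', i, q, hP, hG', hs⟩ := isGClass_GP.up G hG
      exact ⟨⟨G', hG'⟩, P, i, q, hP, hs⟩)
    (fun ⟨G, hG⟩ => by
      obtain ⟨P, G', i, q, hP, hG', hs⟩ := isGClass_GP.down G hG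
      exact ⟨⟨G', hG'⟩, P, i, q, hP, hs⟩) ⟨X, hX⟩
  choose P i q hP hs using hs
  exact ⟨fun n => (s n).1, P, i, q, congrArg Subtype.val h0, fun n => (s n).2, hP, hs⟩

/-- The sequence of `GP.exists_sequence` in the reverse numbering. -/
theorem GP.exists_sequence' {X : C} (hX : GP X) :
    ∃ (G P : ℤ → C) (i : ∀ n, G (n + 1) ⟶ P n) (q : ∀ n, P n ⟶ G n),
      G 0 = X ∧ (∀ n, GP (G n)) ∧ (∀ n, Projective (P n)) ∧ ∀ n, SES (i n) (q n) := by
  obtain ⟨s, h0, hs⟩ := exists_int_path (α := { G : C // GP G })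
    (fun G' G => ∃ (P : C) (i : G.1 ⟶ P) (q : P ⟶ G'.1), Projective P ∧ SES i q)
    (fun ⟨G, hG⟩ => by
      obtain ⟨P, G', i, q, hP, hG', hs⟩ := isGClass_GP.down G hG
      exact ⟨⟨G', hG'⟩, P, i, q, hP, hs⟩)
    (fun ⟨G, hG⟩ => by
      obtain ⟨P, G', i, q, hP, hG', hs⟩ := isGClass_GP.up G hG
      exact ⟨⟨G', hG'⟩, P, i, q, hP, hs⟩) ⟨X, hX⟩
  choose P i q hP hs using hs
  exact ⟨fun n => (s n).1, P, i, q, congrArg Subtype.val h0, fun n => (s n).2, hP, hs⟩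

end CompleteResolutions

/-! ### Translation to modules; Gorenstein regular rings -/

section GorensteinModules

variable {R : Type u} [Ring R]

theorem ses_iff {X Y Z : ModuleCat.{u} R} (i : X ⟶ Y) (q : Y ⟶ Z) :
    SES i q ↔ Function.Injective i ∧ Function.Exact i q ∧ Function.Surjective q := by
  constructor
  · rintro ⟨w, hs⟩
    exact ⟨(ModuleCat.mono_iff_injective i).1 hs.mono_f,
      (ShortComplex.ShortExact.moduleCat_exact_iff_function_exact _).1 hs.exact,
      (ModuleCat.epi_iff_surjective q).1 hs.epi_g⟩
  · rintro ⟨h₁, h₂, h₃⟩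
    have w : i ≫ q = 0 := by
      ext x
      exact h₂.apply_apply_eq_zero x
    exact ⟨w, ShortComplex.ShortExact.mk'
      ((ShortComplex.ShortExact.moduleCat_exact_iff_function_exact _).2 h₂)
      ((ModuleCat.mono_iff_injective i).2 h₁) ((ModuleCat.epi_iff_surjective q).2 h₃)⟩

theorem projective_iff (P : ModuleCat.{u} R) : Projective P ↔ Module.Projective R P :=
  (IsProjective.iff_projective P).symm

theorem injective_iff (E : ModuleCat.{u} R) : Injective E ↔ Module.Injective R E :=
  (Module.injective_iff_injective_object R E).symm

theorem ses_ker {P : ℤ → ModuleCat.{u} R} {d : ∀ n : ℤ, P n →ₗ[R] P (n + 1)}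
    (hd : ∀ n, Function.Exact (d n) (d (n + 1))) (n : ℤ) :
    SES (ModuleCat.ofHom (LinearMap.ker (d n)).subtype)
      (ModuleCat.ofHom ((d n).codRestrict (LinearMap.ker (d (n + 1)))
        (hd n).apply_apply_eq_zero)) := by
  rw [ses_iff]
  refine ⟨Subtype.val_injective, fun x => ?_, fun x => ?_⟩
  · change (⟨d n x, _⟩ : LinearMap.ker (d (n + 1))) = 0 ↔ x ∈ Set.range Subtype.val
    simp [Subtype.ext_iff]
  · obtain ⟨y, hy⟩ := (hd n x.1).1 x.2
    exact ⟨y, Subtype.ext hy⟩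

/-- Splicing short exact sequences gives a long exact sequence. -/
theorem exact_splice {X Y Z W V : ModuleCat.{u} R} {q : X ⟶ Y} {i : Y ⟶ Z} {q' : Z ⟶ W}
    {i' : W ⟶ V} (hq : Function.Surjective q) (hi' : Function.Injective i')
    (h : Function.Exact i q') : Function.Exact (q ≫ i).hom (q' ≫ i').hom := by
  intro x
  simp only [ModuleCat.hom_comp, LinearMap.comp_apply, Set.mem_range, LinearMap.coe_comp,
    Function.comp_apply]
  constructor
  · intro hx
    obtain ⟨y, rfl⟩ := (h x).1 (hi' (hx.trans (map_zero i'.hom).symm))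
    obtain ⟨z, rfl⟩ := hq y
    exact ⟨z, rfl⟩
  · rintro ⟨z, rfl⟩
    rw [h.apply_apply_eq_zero, map_zero]

/-- An injective homomorphism identifies its source with the kernel of `q` composed with an
injective homomorphism. -/
theorem nonempty_equiv_ker {X Y Z W : ModuleCat.{u} R} {i : X ⟶ Y} {q : Y ⟶ Z} {i' : Z ⟶ W}
    (h : SES i q) (hi' : Function.Injective i') :
    Nonempty (X ≃ₗ[R] LinearMap.ker (q ≫ i').hom) := by
  obtain ⟨h₁, h₂, -⟩ := (ses_iff i q).1 h
  refine ⟨LinearEquiv.ofBijective (i.hom.codRestrict _ fun x => ?_)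
    ⟨fun x y hxy => ?_, fun y => ?_⟩⟩
  · exact (congrArg i' (h₂.apply_apply_eq_zero x)).trans (map_zero i'.hom)
  · exact h₁ (congrArg Subtype.val hxy)
  · obtain ⟨x, hx⟩ := (h₂ y.1).1 (hi' (y.2.trans (map_zero i'.hom).symm))
    exact ⟨x, Subtype.ext hx⟩

/-- The kernels of a totally acyclic complex form a class as in `IsGClass`; conversely, the short
exact sequences of such a class splice to a complex. Exactness under `Hom(-, Q)` corresponds to
`Ext¹(-, Q) = 0` on the kernels. -/
theorem gorensteinProjective_iff (M : ModuleCat.{u} R) : GorensteinProjective M ↔ GP M := by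
  constructor
  · rintro ⟨P, d, hP, hd, hQ, ⟨e⟩⟩
    refine GP.of_iso e.symm.toModuleIso ⟨fun X => ∃ n, X = ModuleCat.of R (LinearMap.ker (d n)),
      ⟨?_, ?_, ?_⟩, 0, rfl⟩
    · rintro _ ⟨n, rfl⟩
      exact ⟨P n, _, _, _, (projective_iff _).2 (hP n), ⟨n + 1, rfl⟩, ses_ker hd n⟩
    · rintro _ ⟨n, rfl⟩
      obtain ⟨m, rfl⟩ : ∃ m, n = m + 1 := ⟨n - 1, by ring⟩
      exact ⟨P m, _, _, _, (projective_iff _).2 (hP m), ⟨m, rfl⟩, ses_ker hd m⟩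
    · rintro _ ⟨n, rfl⟩ Q hQ'
      -- A map from the kernel of `d (m + 2)` is pulled back to `P (m + 1)`, where it kills the
      -- image of `d m`; `Hom`-exactness at that place then extends it to `P (m + 2)`.
      obtain ⟨m, rfl⟩ : ∃ m, n = m + 1 + 1 + 1 := ⟨n - 3, by ring⟩
      have := (projective_iff _).2 (hP (m + 1 + 1))
      let := HasExt.standard (ModuleCat.{u} R)
      refine extV_of_ext (ext_eq_zero_of_presentation (ses_ker hd (m + 1 + 1)) fun f => ?_)
      let δ : P (m + 1) →ₗ[R] LinearMap.ker (d (m + 1 + 1)) :=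
        (d (m + 1)).codRestrict _ (hd (m + 1)).apply_apply_eq_zero
      obtain ⟨g, hg⟩ := (hQ Q ((projective_iff Q).1 hQ') m (f.hom ∘ₗ δ)).1 (by
        ext x
        have : δ (d m x) = 0 := Subtype.ext ((hd m).apply_apply_eq_zero x)
        exact (congrArg f this).trans (map_zero f.hom))
      refine ⟨ModuleCat.ofHom g, ?_⟩
      ext ⟨x, hx⟩
      obtain ⟨z, rfl⟩ := (hd (m + 1) x).1 hx
      exact LinearMap.congr_fun hg z
  · intro hM
    obtain ⟨G, P, i, q, rfl, hG, hP, hs⟩ := hM.exists_sequence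
    have hs' := fun n => (ses_iff _ _).1 (hs n)
    refine ⟨P, fun n => (q n ≫ i (n + 1)).hom, fun n => (projective_iff _).1 (hP n),
      fun n => exact_splice (hs' n).2.2 (hs' (n + 1 + 1)).1 (hs' (n + 1)).2.1, ?_,
      nonempty_equiv_ker (hs 0) (hs' (0 + 1)).1⟩
    intro Q hQ n g
    constructor
    · intro hg
      have h1 : q n ≫ i (n + 1) ≫ ModuleCat.ofHom g = 0 := by
        ext x
        exact LinearMap.congr_fun hg x
      have := (hs n).epi
      -- A cocycle factors through the next kernel `G (n + 2)`, and `Ext¹(G (n + 3), Q) = 0` extends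
      -- it to `P (n + 2)`.
      obtain ⟨g', hg'⟩ := (hs (n + 1)).desc (ModuleCat.ofHom g) (by
        rwa [← cancel_epi (q n), comp_zero])
      obtain ⟨f, hf⟩ := isGClass_GP.extV _ (hG _) Q ((projective_iff Q).2 hQ) _ _
        (hs (n + 1 + 1)) g'
      refine ⟨f.hom, ?_⟩
      have : (q (n + 1) ≫ i (n + 1 + 1)) ≫ f = ModuleCat.ofHom g := by
        rw [Category.assoc, hf, hg']
      exact congrArg ModuleCat.Hom.hom this
    · rintro ⟨f, rfl⟩
      ext x
      have := (exact_splice (hs' n).2.2 (hs' (n + 1 + 1)).1 (hs' (n + 1)).2.1).apply_apply_eq_zero x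
      exact (congrArg f this).trans (map_zero f)

theorem gorensteinInjective_iff (M : ModuleCat.{u} R) :
    GorensteinInjective M ↔ GP (Opposite.op M) := by
  constructor
  · rintro ⟨E, d, hE, hd, hI, ⟨e⟩⟩
    refine GP.of_iso e.toModuleIso.op ⟨fun X => ∃ n, X = Opposite.op
      (ModuleCat.of R (LinearMap.ker (d n))), ⟨?_, ?_, ?_⟩, 0, rfl⟩
    · rintro _ ⟨n, rfl⟩
      obtain ⟨m, rfl⟩ : ∃ m, n = m + 1 := ⟨n - 1, by ring⟩
      have := (injective_iff _).2 (hE m)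
      exact ⟨Opposite.op (E m), _, _, _, inferInstance, ⟨m, rfl⟩, (ses_ker hd m).op⟩
    · rintro _ ⟨n, rfl⟩
      have := (injective_iff _).2 (hE n)
      exact ⟨Opposite.op (E n), _, _, _, inferInstance, ⟨n + 1, rfl⟩, (ses_ker hd n).op⟩
    · rintro _ ⟨n, rfl⟩ Q hQ
      have := (injective_iff _).2 (hE n)
      let := HasExt.standard (ModuleCat.{u} R)ᵒᵖ
      refine extV_of_ext (ext_eq_zero_of_presentation (ses_ker hd n).op fun f => ?_)
      let g : Q.unop →ₗ[R] LinearMap.ker (d (n + 1)) := f.unop.hom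
      obtain ⟨g', hg'⟩ := (hI Q.unop ((injective_iff _).1 inferInstance) n
        ((LinearMap.ker (d (n + 1))).subtype ∘ₗ g)).1 (by
          ext x
          exact (g x).2)
      refine ⟨(ModuleCat.ofHom g').op, ?_⟩
      apply Quiver.Hom.unop_inj
      ext x
      exact LinearMap.congr_fun hg' x
  · intro hM
    obtain ⟨G, E, i, q, h0, hG, hE, hs⟩ := hM.exists_sequence'
    obtain rfl : (G 0).unop = M := congrArg Opposite.unop h0
    have hs₁ := fun n => (hs n).unop
    have hs' := fun n => (ses_iff _ _).1 (hs₁ n)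
    have hex : ∀ n, Function.Exact ((i n).unop ≫ (q (n + 1)).unop).hom
        ((i (n + 1)).unop ≫ (q (n + 1 + 1)).unop).hom := fun n =>
      exact_splice (hs' n).2.2 (hs' (n + 1 + 1)).1 (hs' (n + 1)).2.1
    refine ⟨fun n => (E n).unop, fun n => ((i n).unop ≫ (q (n + 1)).unop).hom,
      fun n => (injective_iff _).1 inferInstance, hex, ?_,
      nonempty_equiv_ker (hs₁ 0) (hs' (0 + 1)).1⟩
    intro I hI n g
    constructor
    · intro hg
      have := (hs₁ (n + 1 + 1)).mono
      obtain ⟨g', hg'⟩ := (hs₁ (n + 1)).lift (ModuleCat.ofHom g) (by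
        rw [← cancel_mono (q (n + 1 + 1)).unop, zero_comp]
        ext x
        exact LinearMap.congr_fun hg x)
      have := (injective_iff I).2 hI
      obtain ⟨f, hf⟩ := isGClass_GP.extV _ (hG _) (Opposite.op I) inferInstance _ _ (hs n) g'.op
      refine ⟨f.unop.hom, ?_⟩
      have : f.unop ≫ (i n).unop ≫ (q (n + 1)).unop = ModuleCat.ofHom g := by
        rw [← hg', ← Category.assoc, ← unop_comp, hf]
        rfl
      exact congrArg ModuleCat.Hom.hom this
    · rintro ⟨f, rfl⟩
      ext x
      exact (hex n).apply_apply_eq_zero (f x)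

theorem hasResolution_iff {𝒳 : ModuleCat.{u} R → Prop}
    (h𝒳 : ∀ {X X' : ModuleCat.{u} R}, (X ≅ X') → 𝒳 X → 𝒳 X') (n : ℕ) (M : ModuleCat.{u} R) :
    HasResolution 𝒳 n M ↔ FinRes 𝒳 n M := by
  induction n generalizing M with
  | zero =>
    refine ⟨fun ⟨X, hX, ⟨e⟩⟩ => h𝒳 e.toModuleIso hX, fun h => ⟨M, h, ⟨LinearEquiv.refl _ _⟩⟩⟩
  | succ n ih =>
    constructor
    · rintro ⟨X, K, i, p, hX, hK, h⟩
      exact ⟨X, K, ModuleCat.ofHom i, ModuleCat.ofHom p, hX, (ih K).1 hK, (ses_iff _ _).2 h⟩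
    · rintro ⟨X, K, i, p, hX, hK, h⟩
      exact ⟨X, K, i.hom, p.hom, hX, (ih K).2 hK, (ses_iff _ _).1 h⟩

theorem hasCoresolution_iff {𝒳 : (ModuleCat.{u} R)ᵒᵖ → Prop}
    (h𝒳 : ∀ {X X' : (ModuleCat.{u} R)ᵒᵖ}, (X ≅ X') → 𝒳 X → 𝒳 X') (n : ℕ) (M : ModuleCat.{u} R) :
    HasCoresolution (fun X => 𝒳 (Opposite.op X)) n M ↔ FinRes 𝒳 n (Opposite.op M) := by
  induction n generalizing M with
  | zero =>
    refine ⟨fun ⟨X, hX, ⟨e⟩⟩ => h𝒳 e.toModuleIso.op hX,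
      fun h => ⟨M, h, ⟨LinearEquiv.refl _ _⟩⟩⟩
  | succ n ih =>
    constructor
    · rintro ⟨X, K, i, p, hX, hK, h⟩
      exact ⟨_, _, _, _, hX, (ih K).1 hK,
        SES.op ((ses_iff (ModuleCat.ofHom i) (ModuleCat.ofHom p)).2 h)⟩
    · rintro ⟨X, K, i, p, hX, hK, h⟩
      exact ⟨X.unop, K.unop, p.unop.hom, i.unop.hom, hX, (ih K.unop).2 hK,
        (ses_iff _ _).1 h.unop⟩

theorem resolutionDim_lt_top {𝒳 : ModuleCat.{u} R → Prop} {M : ModuleCat.{u} R} :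
    resolutionDim 𝒳 M < ⊤ ↔ ∃ n, HasResolution 𝒳 n M := by
  simp [resolutionDim, iInf_lt_iff]

theorem coresolutionDim_lt_top {𝒳 : ModuleCat.{u} R → Prop} {M : ModuleCat.{u} R} :
    coresolutionDim 𝒳 M < ⊤ ↔ ∃ n, HasCoresolution 𝒳 n M := by
  simp [coresolutionDim, iInf_lt_iff]

theorem gpd_lt_top_iff (M : Type u) [AddCommGroup M] [Module R M] :
    Gpd R M < ⊤ ↔ FG (ModuleCat.of R M) := by
  have h : (GorensteinProjective : ModuleCat.{u} R → Prop) = GP :=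
    funext fun X => propext (gorensteinProjective_iff X)
  rw [Gpd, resolutionDim_lt_top, h]
  exact exists_congr fun n => hasResolution_iff GP.of_iso n _

theorem gid_lt_top_iff (M : Type u) [AddCommGroup M] [Module R M] :
    Gid R M < ⊤ ↔ FG (Opposite.op (ModuleCat.of R M)) := by
  have h : (GorensteinInjective : ModuleCat.{u} R → Prop) = fun X => GP (Opposite.op X) :=
    funext fun X => propext (gorensteinInjective_iff X)
  rw [Gid, coresolutionDim_lt_top, h]
  exact exists_congr fun n => hasCoresolution_iff GP.of_iso n _

/-- Over a left Gorenstein regular ring, all Gorenstein projective and Gorenstein injective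
dimensions are finite. -/
theorem LeftGorensteinRegular.fg (h : LeftGorensteinRegular R) (X : ModuleCat.{u} R) :
    FG X ∧ FG (Opposite.op X) := by
  obtain ⟨n, hn⟩ := h.finitistic_pd
  obtain ⟨m, hm⟩ := h.finitistic_id
  have hI : ∀ E : ModuleCat.{u} R, Injective E → HasProjectiveDimensionLT E (n + 1) := by
    intro E hE
    have : injectiveDimension E < ⊤ :=
      lt_of_le_of_lt ((injectiveDimension_le_iff E 0).2 inferInstance) (by decide)
    exact (projectiveDimension_le_iff E n).1 (hn E ((h.pd_finite_iff_id_finite E).2 this))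
  have hP : ∀ Q : ModuleCat.{u} R, Projective Q → HasInjectiveDimensionLT Q (m + 1) := by
    intro Q hQ
    have : projectiveDimension Q < ⊤ :=
      lt_of_le_of_lt ((projectiveDimension_le_iff Q 0).2 inferInstance) (by decide)
    exact (injectiveDimension_le_iff Q m).1 (hm Q ((h.pd_finite_iff_id_finite Q).1 this))
  -- In the opposite category injectives and projectives trade places, and so do the bounds `n` and
  -- `m`.
  refine ⟨FG.of_bounded n hI (fun Q hQ => ⟨_, hP Q hQ⟩) X, FG.of_bounded m (fun E hE => ?_)
    (fun Q hQ => ⟨n + 1, ?_⟩) _⟩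
  · exact hasProjectiveDimensionLT_op (hP E.unop inferInstance)
  · exact hasInjectiveDimensionLT_op (hI Q.unop inferInstance)

end GorensteinModules

/-! ### Universal property of the balanced tensor product -/

section BalancedMaps

variable {S A U M N : Type*} [Ring S] [Ring A] [AddCommGroup U] [Module S U] [Module Aᵐᵒᵖ U]
  [AddCommGroup M] [Module A M] [AddCommGroup N]

theorem btmul_induction {P : BalancedTensor S A U M → Prop} (z : BalancedTensor S A U M)
    (h0 : P 0) (h1 : ∀ u m, P (btmul S A u m)) (h2 : ∀ x y, P x → P y → P (x + y)) : P z := by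
  obtain ⟨z, rfl⟩ := Submodule.Quotient.mk_surjective _ z
  induction z using TensorProduct.induction_on with
  | zero => exact h0
  | tmul u m => exact h1 u m
  | add x y hx hy => exact h2 _ _ hx hy

theorem balancedTensor_hom_ext {F G : Type*} [FunLike F (BalancedTensor S A U M) N]
    [AddMonoidHomClass F (BalancedTensor S A U M) N] [FunLike G (BalancedTensor S A U M) N]
    [AddMonoidHomClass G (BalancedTensor S A U M) N] (f : F) (g : G)
    (h : ∀ u m, f (btmul S A u m) = g (btmul S A u m)) (z : BalancedTensor S A U M) :
    f z = g z := by
  induction z using btmul_induction with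
  | h0 => rw [map_zero, map_zero]
  | h1 u m => exact h u m
  | h2 x y hx hy => rw [map_add, map_add, hx, hy]

variable [SMulCommClass S Aᵐᵒᵖ U]

variable (S) in
/-- The additive map on `U ⊗_A M` induced by a balanced biadditive map. -/
def btLift (f : U →+ M →+ N) (hf : ∀ (u : U) (a : A) (m : M), f (op a • u) m = f u (a • m)) :
    BalancedTensor S A U M →+ N :=
  QuotientAddGroup.lift (Submodule.span S (balancingRelations A U M)).toAddSubgroup
    (TensorProduct.liftAddHom f fun r m n => by simp) (by
      -- The lift is only additive while the relations are spanned over `S`. Vanishing on all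
      -- multiples `s • x` survives the scalar step of the span induction; `s = 1` is what is
      -- needed.
      have key : ∀ x ∈ Submodule.span S (balancingRelations A U M), ∀ s : S,
          TensorProduct.liftAddHom f (fun (r : ℤ) m n => by simp) (s • x) = 0 := by
        intro x hx
        induction hx using Submodule.span_induction with
        | mem x hx =>
          intro s
          obtain ⟨u, a, m, hs⟩ := smul_mem_balancingRelations s hx
          rw [hs, map_sub, TensorProduct.liftAddHom_tmul, TensorProduct.liftAddHom_tmul, hf,
            sub_self]
        | zero => simp
        | add x y _ _ hx hy => intro s; rw [smul_add, map_add, hx, hy, add_zero]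
        | smul r x _ hx => intro s; rw [smul_smul, hx]
      intro x hx
      simpa using key x hx 1)

@[simp]
theorem btLift_btmul (f : U →+ M →+ N)
    (hf : ∀ (u : U) (a : A) (m : M), f (op a • u) m = f u (a • m)) (u : U) (m : M) :
    btLift S f hf (btmul S A u m) = f u m := rfl

/-- The `S`-linear map on `U ⊗_A M` induced by a balanced map that is `S`-linear in `U`. -/
def btLinearLift [Module S N] (f : U →+ M →+ N)
    (hf : ∀ (u : U) (a : A) (m : M), f (op a • u) m = f u (a • m))
    (hs : ∀ (s : S) (u : U) (m : M), f (s • u) m = s • f u m) : BalancedTensor S A U M →ₗ[S] N :=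
  { btLift S f hf with
    map_smul' := fun s z => by
      induction z using btmul_induction with
      | h0 => simp
      | h1 u m =>
        change btLift S f hf (s • btmul S A u m) = s • btLift S f hf (btmul S A u m)
        rw [← smul_btmul, btLift_btmul, btLift_btmul, hs]
      | h2 x y hx hy =>
        simp only [smul_add, ZeroHom.toFun_eq_coe, AddMonoidHom.toZeroHom_coe, map_add] at hx hy ⊢
        rw [hx, hy] }

end BalancedMaps

/-! ### Character modules, flatness and injectivity -/

section CharacterDual

variable {A : Type u} [Ring A]

/-- The character module `Hom(U, ℚ/ℤ)` of a right `A`-module, as a left `A`-module. -/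
def RightDual (U : Type*) [AddCommGroup U] : Type _ := U →+ AddCircle (1 : ℚ)

instance (U : Type*) [AddCommGroup U] : AddCommGroup (RightDual U) :=
  inferInstanceAs (AddCommGroup (U →+ AddCircle (1 : ℚ)))

instance (U : Type*) [AddCommGroup U] : FunLike (RightDual U) U (AddCircle (1 : ℚ)) :=
  inferInstanceAs (FunLike (U →+ AddCircle (1 : ℚ)) U (AddCircle (1 : ℚ)))

instance (U : Type*) [AddCommGroup U] : AddMonoidHomClass (RightDual U) U (AddCircle (1 : ℚ)) :=
  inferInstanceAs (AddMonoidHomClass (U →+ AddCircle (1 : ℚ)) U (AddCircle (1 : ℚ)))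

instance (U : Type*) [AddCommGroup U] [Module Aᵐᵒᵖ U] : Module A (RightDual U) where
  smul a c := (AddMonoidHom.comp c (DistribSMul.toAddMonoidHom U (op a)) : U →+ _)
  one_smul c := DFunLike.ext _ _ fun u => congrArg c (one_smul Aᵐᵒᵖ u)
  mul_smul a b c := DFunLike.ext _ _ fun u => congrArg c (mul_smul (op b) (op a) u)
  smul_zero _ := rfl
  smul_add _ _ _ := rfl
  add_smul a b c := DFunLike.ext _ _ fun u =>
    (congrArg c (add_smul (op a) (op b) u)).trans (map_add c _ _)
  zero_smul c := DFunLike.ext _ _ fun u =>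
    (congrArg c (zero_smul Aᵐᵒᵖ u)).trans (map_zero c)

section

variable {U M : Type*} [AddCommGroup U] [Module Aᵐᵒᵖ U] [AddCommGroup M] [Module A M]

theorem rightDual_smul_apply (a : A) (c : RightDual U) (u : U) : (a • c) u = c (op a • u) := rfl

variable (S : Type*) [Ring S] [Module S U] [SMulCommClass S Aᵐᵒᵖ U]

/-- The character of `U ⊗_A M` corresponding to a homomorphism `M → Hom(U, ℚ/ℤ)`. -/
def characterOfHom (g : M →ₗ[A] RightDual U) : BalancedTensor S A U M →+ AddCircle (1 : ℚ) :=
  btLift S (AddMonoidHom.flip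
      (show M →+ (U →+ AddCircle (1 : ℚ)) from g.toAddMonoidHom)) fun u a m => by
    change g m (op a • u) = g (a • m) u
    rw [map_smul g, rightDual_smul_apply]

@[simp]
theorem characterOfHom_btmul (g : M →ₗ[A] RightDual U) (u : U) (m : M) :
    characterOfHom S g (btmul S A u m) = g m u := rfl

/-- The homomorphism `M → Hom(U, ℚ/ℤ)` corresponding to a character of `U ⊗_A M`. -/
def homOfCharacter (c : BalancedTensor S A U M →+ AddCircle (1 : ℚ)) : M →ₗ[A] RightDual U where
  toFun m :=
    (AddMonoidHom.mk' (fun u => c (btmul S A u m)) fun u u' => by rw [add_btmul, map_add] :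
      U →+ AddCircle (1 : ℚ))
  map_add' m m' := DFunLike.ext _ _ fun u => by
    change c (btmul S A u (m + m')) = c (btmul S A u m) + c (btmul S A u m')
    rw [btmul_add, map_add]
  map_smul' a m := DFunLike.ext _ _ fun u => congrArg c (btmul_smul S A u a m)

/-- If homomorphisms `K → Hom(U, ℚ/ℤ)` extend along `i : K → P`, then `U ⊗_A K → U ⊗_A P` is
injective. -/
theorem injective_of_forall_extend {K P : Type*} [AddCommGroup K] [Module A K] [AddCommGroup P]
    [Module A P] (i : K →ₗ[A] P)
    (h : ∀ f : K →ₗ[A] RightDual U, ∃ g : P →ₗ[A] RightDual U, g ∘ₗ i = f)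
    (F : BalancedTensor S A U K →+ BalancedTensor S A U P)
    (hF : ∀ u k, F (btmul S A u k) = btmul S A u (i k)) : Function.Injective F := by
  rw [injective_iff_map_eq_zero]
  intro z hz
  refine CharacterModule.eq_zero_of_character_apply fun c => ?_
  -- By tensor-hom adjunction every character of `U ⊗ K` is then the pullback along `F` of one of `U
  -- ⊗ P`, so it vanishes on the kernel of `F`; characters separate points.
  obtain ⟨g, hg⟩ := h (homOfCharacter S c)
  have : (characterOfHom S g).comp F z = c z := by
    refine balancedTensor_hom_ext (((characterOfHom S g).comp F : _ →+ _)) c (fun u k => ?_) z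
    rw [AddMonoidHom.comp_apply, hF, characterOfHom_btmul]
    exact congrArg (fun f : K →ₗ[A] RightDual U => f k u) hg
  rw [← this, AddMonoidHom.comp_apply, hz, map_zero]

end

/-- Lambek's argument: maps `X → Hom(U, ℚ/ℤ)` are characters of `U ⊗ X`, and these extend along the
injection `U ⊗ X → U ⊗ Y` because `ℚ/ℤ` is injective. -/
theorem FlatRight.injective {U : ModuleCat.{u} Aᵐᵒᵖ} (hU : FlatRight U) :
    Injective (ModuleCat.of A (RightDual U)) := by
  refine ⟨fun {X Y} f i hi => ?_⟩
  have hinj := hU X Y i.hom ((ModuleCat.mono_iff_injective i).1 hi)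
  obtain ⟨c, hc⟩ := CharacterModule.dual_surjective_of_injective _ hinj (characterOfHom ℤ f.hom)
  refine ⟨ModuleCat.ofHom (homOfCharacter ℤ c), ?_⟩
  ext x
  refine DFunLike.ext (F := RightDual U) _ _ fun u => ?_
  exact DFunLike.congr_fun hc (btmul ℤ A u x)

/-- The homomorphism of character modules induced by a homomorphism of right modules. -/
def rightDualMap {U V : ModuleCat.{u} Aᵐᵒᵖ} (f : U →ₗ[Aᵐᵒᵖ] V) :
    ModuleCat.of A (RightDual V) ⟶ ModuleCat.of A (RightDual U) :=
  ModuleCat.ofHom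
    { toFun := fun c => (AddMonoidHom.comp c f.toAddMonoidHom : U →+ AddCircle (1 : ℚ))
      map_add' := fun _ _ => rfl
      map_smul' := fun a c => DFunLike.ext (F := RightDual U) _ _ fun u =>
        congrArg c (map_smul f (op a) u).symm }

theorem ses_rightDualMap {K F U : ModuleCat.{u} Aᵐᵒᵖ} {i : K →ₗ[Aᵐᵒᵖ] F} {p : F →ₗ[Aᵐᵒᵖ] U}
    (hi : Function.Injective i) (hex : Function.Exact i p) (hp : Function.Surjective p) :
    SES (rightDualMap p) (rightDualMap i) := by
  rw [ses_iff]
  refine ⟨fun c c' h => DFunLike.ext (F := RightDual U) _ _ fun x => ?_, fun c => ⟨fun h => ?_, ?_⟩,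
    fun c => ?_⟩
  · obtain ⟨y, rfl⟩ := hp x
    exact DFunLike.congr_fun (F := RightDual F) h y
  · refine ⟨(AddMonoidHom.liftOfSurjective p.toAddMonoidHom hp
      ⟨(c : F →+ AddCircle (1 : ℚ)), fun x hx => ?_⟩ : U →+ AddCircle (1 : ℚ)), ?_⟩
    · obtain ⟨y, rfl⟩ := (hex x).1 hx
      exact DFunLike.congr_fun (F := RightDual K) h y
    · exact DFunLike.ext (F := RightDual F) _ _ fun x =>
        AddMonoidHom.liftOfRightInverse_comp_apply _ _ (Function.rightInverse_surjInv hp) _ x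
  · rintro ⟨c, rfl⟩
    exact DFunLike.ext (F := RightDual K) _ _ fun x =>
      (congrArg c (hex.apply_apply_eq_zero x)).trans (map_zero (c : RightDual U))
  · obtain ⟨c', h⟩ := CharacterModule.dual_surjective_of_injective
      i.toAddMonoidHom.toIntLinearMap hi (c : K →+ AddCircle (1 : ℚ))
    exact ⟨c', h⟩

/-- The injective dimension of the character module is at most the flat dimension. -/
theorem hasInjectiveDimensionLT_rightDual {n : ℕ} {U : ModuleCat.{u} Aᵐᵒᵖ}
    (h : HasResolution FlatRight n U) :
    HasInjectiveDimensionLT (ModuleCat.of A (RightDual U)) (n + 1) := by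
  induction n generalizing U with
  | zero =>
    obtain ⟨F, hF, ⟨e⟩⟩ := h
    have := hF.injective
    refine injective_iff_hasInjectiveDimensionLT_one.1
      (Injective.of_iso (P := .of A (RightDual F)) ?_ this)
    exact
      { hom := rightDualMap e.symm.toLinearMap
        inv := rightDualMap e.toLinearMap
        hom_inv_id := by
          ext c
          exact DFunLike.ext (F := RightDual F) _ _ fun x => congrArg c (e.symm_apply_apply x)
        inv_hom_id := by
          ext c
          exact DFunLike.ext (F := RightDual U) _ _ fun x => congrArg c (e.apply_symm_apply x) }
  | succ n ih =>
    obtain ⟨F, K, i, p, hF, hK, hi, hex, hp⟩ := h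
    obtain ⟨w, hs⟩ := ses_rightDualMap hi hex hp
    exact (hs.hasInjectiveDimensionLT_X₃_iff n hF.injective).1 (ih hK)

end CharacterDual

/-! ### Corners at an idempotent and their adjunctions with restriction -/

section Corner

variable {S T : Type u} [Ring S] [Ring T] (ι : S →ₙ+* T)

/-- The part of a `T`-module on which the idempotent `ι 1` acts as the identity. -/
def corner (M : Type*) [AddCommGroup M] [Module T M] : AddSubgroup M where
  carrier := {m | ι 1 • m = m}
  add_mem' hx hy := (smul_add _ _ _).trans (congrArg₂ _ hx hy)
  zero_mem' := smul_zero _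
  neg_mem' hx := (smul_neg _ _).trans (congrArg _ hx)

variable {M N : Type*} [AddCommGroup M] [Module T M] [AddCommGroup N] [Module T N]

theorem smul_mem_corner (s : S) (m : M) : ι s • m ∈ corner ι M :=
  (smul_smul _ _ _).trans (by rw [← map_mul, one_mul])

instance : Module S (corner ι M) where
  smul s m := ⟨ι s • m.1, smul_mem_corner ι s m.1⟩
  one_smul m := Subtype.ext m.2
  mul_smul s t m := Subtype.ext ((congrArg (· • m.1) (map_mul ι s t)).trans (mul_smul _ _ _))
  smul_zero _ := Subtype.ext (smul_zero _)
  smul_add _ _ _ := Subtype.ext (smul_add _ _ _)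
  add_smul s t m := Subtype.ext ((congrArg (· • m.1) (map_add ι s t)).trans (add_smul _ _ _))
  zero_smul m := Subtype.ext ((congrArg (· • m.1) (map_zero ι)).trans (zero_smul _ _))

variable {ι} in
@[simp]
theorem corner_coe_smul (s : S) (m : corner ι M) : (s • m : corner ι M).1 = ι s • m.1 := rfl

/-- The restriction of a homomorphism to the corners. -/
def cornerMap (f : M →ₗ[T] N) : corner ι M →ₗ[S] corner ι N where
  toFun m := ⟨f m.1, (map_smul f _ _).symm.trans (congrArg f m.2)⟩
  map_add' _ _ := Subtype.ext (map_add f _ _)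
  map_smul' _ _ := Subtype.ext (map_smul f _ _)

/-- The functor taking a `T`-module to its corner. -/
def cornerFunctor : ModuleCat.{u} T ⥤ ModuleCat.{u} S where
  obj M := ModuleCat.of S (corner ι M)
  map f := ModuleCat.ofHom (cornerMap ι f.hom)

variable {ι}

/-- The homomorphism `M → X` of `T`-modules given by a homomorphism from the corner of `M`. -/
def toRestrict (π : T →+* S) (h : ∀ t, ι 1 * t = ι (π t)) (X : ModuleCat.{u} S)
    (f : corner ι M →ₗ[S] X) : M →ₗ[T] (ModuleCat.restrictScalars π).obj X where
  toFun m := f ⟨ι 1 • m, smul_mem_corner ι 1 m⟩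
  map_add' m n := (congrArg f (Subtype.ext (smul_add _ _ _))).trans (map_add f _ _)
  map_smul' t m := by
    refine Eq.trans (congrArg f (Subtype.ext ?_)) (map_smul f (π t) _)
    change ι 1 • t • m = ι (π t) • ι 1 • m
    rw [smul_smul, smul_smul, h, ← map_mul, mul_one]

/-- If `ι 1 * t = ι (π t)`, the corner functor is left adjoint to restriction along `π`. -/
def cornerAdjRestrict (π : T →+* S) (h : ∀ t, ι 1 * t = ι (π t)) (hπ : ∀ s, π (ι s) = s) :
    cornerFunctor ι ⊣ ModuleCat.restrictScalars.{u} π :=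
  Adjunction.mkOfHomEquiv
    { homEquiv := fun M X =>
        { toFun := fun f => ModuleCat.ofHom (Y := (ModuleCat.restrictScalars π).obj X)
            (toRestrict (M := M) π h X f.hom)
          invFun := fun g => ModuleCat.ofHom
            { toFun := fun m : corner ι M => (show X from g.hom m.1)
              map_add' := fun m n => map_add g.hom _ _
              map_smul' := fun s m => by
                refine (map_smul g.hom (ι s) m.1).trans ?_
                change π (ι s) • (show X from g.hom m.1) = _
                rw [hπ]
                rfl }
          left_inv := fun f => by
            ext m
            exact congrArg f.hom (Subtype.ext m.2)
          right_inv := fun g => by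
            ext m
            refine (map_smul g.hom (ι 1) m).trans ?_
            change π (ι 1) • (show X from g.hom m) = _
            rw [hπ, one_smul]
            rfl }
      homEquiv_naturality_left_symm := fun _ _ => rfl
      homEquiv_naturality_right := fun _ _ => rfl }

/-- A homomorphism from a restricted module takes values in the corner. -/
def ofRestrict (π : T →+* S) (hπ : ∀ s, π (ι s) = s) (Y : ModuleCat.{u} S)
    (f : (ModuleCat.restrictScalars π).obj Y →ₗ[T] M) : Y →ₗ[S] corner ι M where
  toFun y := ⟨f y, by
    refine (map_smul f (ι 1) (show (ModuleCat.restrictScalars π).obj Y from y)).symm.trans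
      (congrArg f ?_)
    exact (congrArg (fun s : S => s • (show Y from y)) (hπ 1)).trans (one_smul S _)⟩
  map_add' y z := Subtype.ext (map_add f _ _)
  map_smul' s y := Subtype.ext (by
    refine Eq.trans (congrArg f ?_)
      (map_smul f (ι s) (show (ModuleCat.restrictScalars π).obj Y from y))
    exact congrArg (fun s : S => s • (show Y from y)) (hπ s).symm)

/-- A homomorphism to a corner as a homomorphism from the restricted module. -/
def restrictLift (π : T →+* S) (h : ∀ t, t * ι 1 = ι (π t)) (Y : ModuleCat.{u} S)
    (g : Y →ₗ[S] corner ι M) : (ModuleCat.restrictScalars π).obj Y →ₗ[T] M where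
  toFun y := (g y).1
  map_add' y z := congrArg Subtype.val (map_add g y z)
  map_smul' t y := by
    refine (congrArg Subtype.val (map_smul g (π t) y)).trans ?_
    refine (congrArg (· • (g y).1) (h t).symm).trans ((mul_smul _ _ _).trans ?_)
    exact congrArg (t • ·) (g y).2

/-- If `t * ι 1 = ι (π t)`, the corner functor is right adjoint to restriction along `π`. -/
def restrictAdjCorner (π : T →+* S) (h : ∀ t, t * ι 1 = ι (π t)) (hπ : ∀ s, π (ι s) = s) :
    ModuleCat.restrictScalars.{u} π ⊣ cornerFunctor ι :=
  Adjunction.mkOfHomEquiv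
    { homEquiv := fun Y M =>
        { toFun := fun f => ModuleCat.ofHom (ofRestrict (M := M) π hπ Y f.hom)
          invFun := fun g => ModuleCat.ofHom (X := (ModuleCat.restrictScalars π).obj Y)
            (restrictLift (M := M) π h Y g.hom)
          left_inv := fun _ => rfl
          right_inv := fun _ => rfl }
      homEquiv_naturality_left_symm := fun _ _ => rfl
      homEquiv_naturality_right := fun _ _ => rfl }

end Corner

/-! ### The two corners of the triangular matrix ring -/

namespace TriRing

/-- The element of the triangular matrix ring given by `u ∈ U`. -/
def low {A U B : Type*} [Ring A] [Ring B] (u : U) : TriRing A U B := ⟨0, u, 0⟩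

section

variable {A U B : Type*} [Ring A] [Ring B] [AddCommGroup U]

theorem low_add (u v : U) : (low (u + v) : TriRing A U B) = low u + low v := by
  ext <;> simp [low]

variable [Module B U] [Module Aᵐᵒᵖ U]

theorem low_mul (u : U) (t : TriRing A U B) : low u * t = (low (op t.a • u) : TriRing A U B) := by
  ext <;> simp [low]

theorem mul_low (u : U) (t : TriRing A U B) : t * low u = (low (t.b • u) : TriRing A U B) := by
  ext <;> simp [low]

end

variable (A U B : Type u) [Ring A] [Ring B] [AddCommGroup U] [Module B U] [Module Aᵐᵒᵖ U]
  [SMulCommClass B Aᵐᵒᵖ U]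

/-- The inclusion of the upper left corner. -/
def inl : A →ₙ+* TriRing A U B where
  toFun a := ⟨a, 0, 0⟩
  map_mul' a a' := by ext <;> simp
  map_zero' := rfl
  map_add' a a' := by ext <;> simp

/-- The inclusion of the lower right corner. -/
def inr : B →ₙ+* TriRing A U B where
  toFun b := ⟨0, 0, b⟩
  map_mul' b b' := by ext <;> simp
  map_zero' := rfl
  map_add' b b' := by ext <;> simp

/-- The projection to the upper left entry. -/
def fst : TriRing A U B →+* A where
  toFun t := t.a
  map_mul' _ _ := rfl
  map_one' := rfl
  map_zero' := rfl
  map_add' _ _ := rfl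

/-- The projection to the lower right entry. -/
def snd : TriRing A U B →+* B where
  toFun t := t.b
  map_mul' _ _ := rfl
  map_one' := rfl
  map_zero' := rfl
  map_add' _ _ := rfl

variable {A U B}

theorem inl_apply (a : A) : inl A U B a = ⟨a, 0, 0⟩ := rfl
theorem inr_apply (b : B) : inr A U B b = ⟨0, 0, b⟩ := rfl

/-- The zero in the upper right entry makes `e₁ ⊣ i₁` an adjunction; `mul_inr_one` does the same for
`i₂ ⊣ e₂`. -/
theorem inl_one_mul (t : TriRing A U B) : inl A U B 1 * t = inl A U B (fst A U B t) := by
  ext <;> simp [inl_apply, fst]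

theorem mul_inr_one (t : TriRing A U B) : t * inr A U B 1 = inr A U B (snd A U B t) := by
  ext <;> simp [inr_apply, snd]

theorem inl_add_inr : inl A U B 1 + inr A U B 1 = 1 := by
  ext <;> simp [inl_apply, inr_apply]

variable {M : Type*} [AddCommGroup M] [Module (TriRing A U B) M]

theorem smul_of_mem_corner_inl {m : M} (hm : m ∈ corner (inl A U B) M) (t : TriRing A U B) :
    t • m = inl A U B t.a • m + (low t.u : TriRing A U B) • m := by
  have h : t * inl A U B 1 = inl A U B t.a + low t.u := by ext <;> simp [inl_apply, low]
  have hm : inl A U B 1 • m = m := hm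
  rw [← add_smul, ← h, mul_smul, hm]

theorem smul_of_mem_corner_inr {m : M} (hm : m ∈ corner (inr A U B) M) (t : TriRing A U B) :
    t • m = inr A U B t.b • m := by
  have hm : inr A U B 1 • m = m := hm
  have h : inr A U B t.b = t * inr A U B 1 := (mul_inr_one t).symm
  rw [h, mul_smul, hm]

theorem low_smul_mem (u : U) (m : M) : (low u : TriRing A U B) • m ∈ corner (inr A U B) M := by
  change inr A U B 1 • (low u : TriRing A U B) • m = (low u : TriRing A U B) • m
  rw [smul_smul, mul_low]
  simp [inr_apply]

end TriRing

/-! ### The gluing sequence and the functors `p` and `h` -/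

section Functors

variable {A U B : Type u} [Ring A] [Ring B] [AddCommGroup U] [Module B U] [Module Aᵐᵒᵖ U]
  [SMulCommClass B Aᵐᵒᵖ U]

open TriRing

/-- The maps are the inclusion of `inr 1 • M` and `m ↦ inl 1 • m`; exactness holds as the two
idempotents are orthogonal with sum `1`. -/
theorem ses_corners (M : ModuleCat.{u} (TriRing A U B)) :
    SES ((restrictAdjCorner (ι := inr A U B) (snd A U B) mul_inr_one fun _ => rfl).counit.app M)
      ((cornerAdjRestrict (ι := inl A U B) (fst A U B) inl_one_mul fun _ => rfl).unit.app M) := by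
  rw [ses_iff]
  refine ⟨fun x y h => Subtype.ext h, fun m => ⟨fun h => ?_, ?_⟩, fun x => ⟨x.1, Subtype.ext x.2⟩⟩
  · have h0 : inl A U B 1 • m = 0 := congrArg Subtype.val h
    refine ⟨(⟨m, (?_ : inr A U B 1 • m = m)⟩ : corner (inr A U B) M), rfl⟩
    have := congrArg (· • m) (inl_add_inr (A := A) (U := U) (B := B))
    simpa only [add_smul, h0, zero_add, one_smul] using this
  · rintro ⟨⟨m, hm⟩, rfl⟩
    refine Subtype.ext (?_ : inl A U B 1 • m = 0)
    rw [← show inr A U B 1 • m = m from hm, smul_smul, mul_inr_one]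
    have : inr A U B (snd A U B (inl A U B 1)) = 0 := rfl
    rw [this, zero_smul]

section TriModule

variable {M₁ M₂ : Type u} [AddCommGroup M₁] [Module A M₁] [AddCommGroup M₂] [Module B M₂]
  (φ : BalancedTensor B A U M₁ →ₗ[B] M₂)

theorem triModule_smul (t : TriRing A U B) (m : TriModule φ) :
    t • m = ((t.a • m.1, φ (btmul B A t.u m.1) + t.b • m.2) : M₁ × M₂) := rfl

theorem inl_smul_triModule (a : A) (m : TriModule φ) :
    inl A U B a • m = ((a • m.1, 0) : M₁ × M₂) := by
  rw [triModule_smul]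
  refine Prod.ext rfl ?_
  change φ (btmul B A (0 : U) m.1) + (0 : B) • m.2 = 0
  rw [show btmul B A (0 : U) m.1 = 0 by simp [btmul], map_zero, zero_smul, add_zero]

theorem inr_smul_triModule (b : B) (m : TriModule φ) :
    inr A U B b • m = ((0, b • m.2) : M₁ × M₂) := by
  rw [triModule_smul]
  refine Prod.ext (zero_smul A m.1) ?_
  change φ (btmul B A (0 : U) m.1) + b • m.2 = b • m.2
  rw [show btmul B A (0 : U) m.1 = 0 by simp [btmul], map_zero, zero_add]

theorem low_smul_triModule (u : U) (m : TriModule φ) :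
    (low u : TriRing A U B) • m = ((0, φ (btmul B A u m.1)) : M₁ × M₂) := by
  rw [triModule_smul]
  refine Prod.ext (zero_smul A m.1) ?_
  change φ (btmul B A u m.1) + (0 : B) • m.2 = φ (btmul B A u m.1)
  rw [zero_smul, add_zero]

/-- The upper component of a column, as a corner. -/
def cornerTriModuleFst : corner (inl A U B) (TriModule φ) ≃ₗ[A] M₁ where
  toFun m := m.1.1
  invFun x := ⟨((x, 0) : M₁ × M₂), (inl_smul_triModule φ 1 _).trans
    (Prod.ext (one_smul A x) rfl)⟩
  map_add' _ _ := rfl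
  map_smul' _ _ := rfl
  left_inv m := Subtype.ext (by
    refine Eq.trans ?_ m.2
    rw [inl_smul_triModule]
    exact Prod.ext (one_smul A m.1.1).symm rfl)
  right_inv _ := rfl

/-- The lower component of a column, as a corner. -/
def cornerTriModuleSnd : corner (inr A U B) (TriModule φ) ≃ₗ[B] M₂ where
  toFun m := m.1.2
  invFun x := ⟨((0, x) : M₁ × M₂), (inr_smul_triModule φ 1 _).trans
    (Prod.ext rfl (one_smul B x))⟩
  map_add' _ _ := rfl
  map_smul' b m := congrArg Prod.snd (inr_smul_triModule φ b m.1)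
  left_inv m := Subtype.ext (by
    refine Eq.trans ?_ m.2
    rw [inr_smul_triModule]
    exact Prod.ext rfl (one_smul B m.1.2).symm)
  right_inv _ := rfl

end TriModule

section Induced

/-- The column `(X; U ⊗ X)`. -/
abbrev Induced (A U B : Type u) [Ring A] [Ring B] [AddCommGroup U] [Module B U]
    [Module Aᵐᵒᵖ U] (X : Type u) [AddCommGroup X] [Module A X] : Type u :=
  TriModule (LinearMap.id : BalancedTensor B A U X →ₗ[B] BalancedTensor B A U X)

variable {X : Type u} [AddCommGroup X] [Module A X] {M : Type u} [AddCommGroup M]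
  [Module (TriRing A U B) M]

/-- The action of `U` on a homomorphism to the upper left corner. -/
def inducedLow (g : X →ₗ[A] corner (inl A U B) M) :
    BalancedTensor B A U X →ₗ[B] corner (inr A U B) M :=
  btLinearLift
    (AddMonoidHom.mk' (fun u => AddMonoidHom.mk'
        (fun x => ⟨(low u : TriRing A U B) • (g x).1, low_smul_mem u _⟩)
        fun x y => Subtype.ext
          ((congrArg (fun z => (low u : TriRing A U B) • z.1) (map_add g x y)).trans
            (smul_add _ _ _)))
      fun u v => by
        ext x
        exact (congrArg (· • (g x).1) (low_add u v)).trans (add_smul _ _ _))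
    (fun u a x => Subtype.ext (by
      change (low (op a • u) : TriRing A U B) • (g x).1 = (low u : TriRing A U B) • (g (a • x)).1
      rw [map_smul g, corner_coe_smul, smul_smul, low_mul]
      rfl))
    (fun b u x => Subtype.ext (by
      change (low (b • u) : TriRing A U B) • (g x).1 =
        inr A U B b • (low u : TriRing A U B) • (g x).1
      rw [smul_smul, mul_low]
      rfl))

@[simp]
theorem inducedLow_btmul (g : X →ₗ[A] corner (inl A U B) M) (u : U) (x : X) :
    (inducedLow g (btmul B A u x)).1 = (low u : TriRing A U B) • (g x).1 := rfl

/-- The homomorphism from `(X; U ⊗ X)` extending `g`. -/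
def inducedLift (g : X →ₗ[A] corner (inl A U B) M) : Induced A U B X →ₗ[TriRing A U B] M where
  toFun z := (g z.1).1 + (inducedLow g z.2).1
  map_add' z w := by
    change (g (z.1 + w.1)).1 + (inducedLow g (z.2 + w.2)).1 = _
    rw [map_add, map_add, AddSubgroup.coe_add, AddSubgroup.coe_add]
    abel
  map_smul' t z := by
    change (g (t.a • z.1)).1 + (inducedLow g (btmul B A t.u z.1 + t.b • z.2)).1 =
      t • ((g z.1).1 + (inducedLow g z.2).1)
    rw [map_smul, map_add, map_smul, AddSubgroup.coe_add, inducedLow_btmul, smul_add,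
      smul_of_mem_corner_inl (g z.1).2 t, smul_of_mem_corner_inr (inducedLow g z.2).2 t,
      corner_coe_smul, corner_coe_smul, add_assoc]

variable (A U B) in
/-- The universal property of `(X; U ⊗ X)`. -/
def inducedEquiv (X : ModuleCat.{u} A) (M : ModuleCat.{u} (TriRing A U B)) :
    (ModuleCat.of (TriRing A U B) (Induced A U B X) ⟶ M) ≃
      (X ⟶ (cornerFunctor (inl A U B)).obj M) where
  toFun f := ModuleCat.ofHom (cornerMap _ f.hom ∘ₗ (cornerTriModuleFst _).symm.toLinearMap)
  invFun g := ModuleCat.ofHom (inducedLift (M := M) g.hom)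
  left_inv f := by
    ext z
    -- The upper component determines `f`, since `(0; u ⊗ x)` is `low u` applied to `(x; 0)`.
    have h2 : ∀ w : BalancedTensor B A U X,
        (inducedLow (M := M) (cornerMap _ f.hom ∘ₗ (cornerTriModuleFst _).symm.toLinearMap) w).1 =
          f.hom ((0, w) : X × BalancedTensor B A U X) := by
      intro w
      induction w using btmul_induction with
      | h0 =>
        rw [map_zero]
        exact (map_zero f.hom).symm
      | h1 u x =>
        rw [inducedLow_btmul]
        refine (map_smul f.hom _ _).symm.trans (congrArg f.hom ?_)
        rw [low_smul_triModule]
        rfl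
      | h2 x y hx hy =>
        rw [map_add, AddSubgroup.coe_add, hx, hy]
        refine (map_add f.hom _ _).symm.trans (congrArg f.hom ?_)
        exact Prod.ext (add_zero _) rfl
    refine (congrArg _ (h2 z.2)).trans ?_
    refine (map_add f.hom ((z.1, 0) : X × BalancedTensor B A U X) _).symm.trans
      (congrArg f.hom ?_)
    exact Prod.ext (add_zero z.1) (zero_add z.2)
  right_inv g := by
    ext x
    change (g.hom x : corner (inl A U B) M).1 + (inducedLow (M := M) g.hom 0).1 = _
    rw [map_zero]
    exact add_zero _

variable (A U B) in
/-- The functor `X ↦ (X; U ⊗ X)`. -/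
def inducedFunctor : ModuleCat.{u} A ⥤ ModuleCat.{u} (TriRing A U B) :=
  Adjunction.leftAdjointOfEquiv (inducedEquiv A U B) fun _ _ _ _ _ => rfl

variable (A U B) in
/-- The functor `X ↦ (X; U ⊗ X)` is left adjoint to taking the upper component. -/
def inducedAdj : inducedFunctor A U B ⊣ cornerFunctor (inl A U B) :=
  Adjunction.adjunctionOfEquivLeft (inducedEquiv A U B) fun _ _ _ _ _ => rfl

/-- `K ↦ (K; U ⊗ K)` preserves a monomorphism along which homomorphisms to `Hom(U, ℚ/ℤ)` extend. -/
theorem mono_inducedFunctor_map {K P : ModuleCat.{u} A} (i : K ⟶ P) [Mono i]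
    (h : ∀ f : K ⟶ ModuleCat.of A (RightDual U),
      ∃ g : P ⟶ ModuleCat.of A (RightDual U), i ≫ g = f) :
    Mono ((inducedFunctor A U B).map i) := by
  rw [ModuleCat.mono_iff_injective, injective_iff_map_eq_zero]
  let G : K →ₗ[A] corner (inl A U B) (Induced A U B P) :=
    (cornerTriModuleFst _).symm.toLinearMap ∘ₗ i.hom
  -- `F` is `1 ⊗ i`, read off in the lower corner of `(P; U ⊗ P)`.
  let F : BalancedTensor B A U K →+ BalancedTensor B A U P :=
    ((cornerTriModuleSnd (LinearMap.id : BalancedTensor B A U P →ₗ[B] _)).toLinearMap ∘ₗ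
      inducedLow G).toAddMonoidHom
  have hF : Function.Injective F := by
    refine injective_of_forall_extend B i.hom (fun f => ?_) F fun u k => ?_
    · obtain ⟨g, hg⟩ := h (ModuleCat.ofHom f)
      exact ⟨g.hom, congrArg ModuleCat.Hom.hom hg⟩
    · exact congrArg Prod.snd (low_smul_triModule LinearMap.id u (G k).1)
  intro (z : Induced A U B K) hz
  have hz' : (G z.1).1 + (inducedLow G z.2).1 = (0 : Induced A U B P) := hz
  have h1 : z.1 = 0 := by
    apply (ModuleCat.mono_iff_injective i).1 inferInstance
    have h0 : (inducedLow G z.2).1.1 = 0 :=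
      (congrArg Prod.fst (inducedLow G z.2).2).symm.trans
        (congrArg Prod.fst (inr_smul_triModule LinearMap.id 1 (inducedLow G z.2).1))
    have h3 : i.hom z.1 + (inducedLow G z.2).1.1 = 0 := congrArg Prod.fst hz'
    rw [h0, add_zero] at h3
    exact h3.trans (map_zero i.hom).symm
  have h2 : z.2 = 0 := by
    apply hF
    rw [map_zero]
    rw [h1, map_zero] at hz'
    exact congrArg Prod.snd ((zero_add _).symm.trans hz')
  exact Prod.ext h1 h2

end Induced

section Coinduced

/-- The column `(Hom_B(U, N); N)`. -/
@[nolint unusedArguments]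
def Coinduced (A U : Type u) [Ring A] [AddCommGroup U] [Module B U] [Module Aᵐᵒᵖ U] (N : Type u)
    [AddCommGroup N] [Module B N] : Type u := (U →ₗ[B] N) × N

variable {N : Type u} [AddCommGroup N] [Module B N]

instance : AddCommGroup (Coinduced (B := B) A U N) :=
  inferInstanceAs (AddCommGroup ((U →ₗ[B] N) × N))

/-- Right multiplication by `a` on `U`. -/
def rightMul (a : A) : U →ₗ[B] U where
  toFun u := op a • u
  map_add' := smul_add _
  map_smul' b u := (smul_comm b (op a) u).symm

instance : Module (TriRing A U B) (Coinduced (B := B) A U N) where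
  smul t m := ((m.1 ∘ₗ rightMul t.a, m.1 t.u + t.b • m.2) : (U →ₗ[B] N) × N)
  one_smul m := Prod.ext (LinearMap.ext fun u => congrArg m.1 (one_smul Aᵐᵒᵖ u)) (by
    change m.1 0 + (1 : B) • m.2 = m.2
    simp)
  mul_smul s t m := Prod.ext (LinearMap.ext fun u =>
      congrArg m.1 (mul_smul (op t.a) (op s.a) u)) (by
    change m.1 (op t.a • s.u + s.b • t.u) + (s.b * t.b) • m.2 =
      m.1 (op t.a • s.u) + s.b • (m.1 t.u + t.b • m.2)
    rw [map_add, map_smul m.1, smul_add, mul_smul, add_assoc])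
  smul_zero t := Prod.ext (LinearMap.zero_comp _) (by
    change (0 : U →ₗ[B] N) t.u + t.b • (0 : N) = 0
    simp)
  smul_add t m n := Prod.ext (LinearMap.add_comp _ _ _) (by
    change (m.1 + n.1) t.u + t.b • (m.2 + n.2) = (m.1 t.u + t.b • m.2) + (n.1 t.u + t.b • n.2)
    rw [LinearMap.add_apply, smul_add]
    abel)
  add_smul s t m := Prod.ext (LinearMap.ext fun u =>
      (congrArg m.1 (add_smul (op s.a) (op t.a) u)).trans (map_add m.1 _ _)) (by
    change m.1 (s.u + t.u) + (s.b + t.b) • m.2 = (m.1 s.u + s.b • m.2) + (m.1 t.u + t.b • m.2)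
    rw [map_add, add_smul]
    abel)
  zero_smul m := Prod.ext (LinearMap.ext fun u =>
      (congrArg m.1 (zero_smul Aᵐᵒᵖ u)).trans (map_zero m.1)) (by
    change m.1 0 + (0 : B) • m.2 = 0
    simp)

theorem inr_smul_coinduced (b : B) (m : Coinduced (B := B) A U N) :
    inr A U B b • m = ((0, b • m.2) : (U →ₗ[B] N) × N) :=
  Prod.ext (LinearMap.ext fun u => (congrArg m.1 (zero_smul Aᵐᵒᵖ u)).trans (map_zero m.1)) (by
    change m.1 0 + b • m.2 = b • m.2
    rw [map_zero, zero_add])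

/-- The lower component of `(Hom_B(U, N); N)`, as a corner. -/
def cornerCoinduced : corner (inr A U B) (Coinduced (B := B) A U N) ≃ₗ[B] N where
  toFun m := m.1.2
  invFun x := ⟨((0, x) : (U →ₗ[B] N) × N), (inr_smul_coinduced 1 _).trans
    (Prod.ext rfl (one_smul B x))⟩
  map_add' _ _ := rfl
  map_smul' b m := congrArg Prod.snd (inr_smul_coinduced b m.1)
  left_inv m := Subtype.ext (by
    refine Eq.trans ?_ m.2
    rw [inr_smul_coinduced]
    exact Prod.ext rfl (one_smul B m.1.2).symm)
  right_inv _ := rfl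

variable {M : Type u} [AddCommGroup M] [Module (TriRing A U B) M]

/-- The homomorphism to `(Hom_B(U, N); N)` extending `g`. -/
def coinducedLift (g : corner (inr A U B) M →ₗ[B] N) :
    M →ₗ[TriRing A U B] Coinduced (B := B) A U N where
  toFun m :=
    (({ toFun := fun u => g ⟨(low u : TriRing A U B) • m, low_smul_mem u m⟩
        map_add' := fun u v => by
          rw [← map_add]
          exact congrArg g (Subtype.ext
            ((congrArg (· • m) (low_add u v)).trans (add_smul _ _ _)))
        map_smul' := fun b u => by
          rw [← map_smul]
          refine congrArg g (Subtype.ext ?_)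
          change (low (b • u) : TriRing A U B) • m = inr A U B b • (low u : TriRing A U B) • m
          rw [smul_smul, mul_low]
          rfl } : U →ₗ[B] N),
      g ⟨inr A U B 1 • m, smul_mem_corner _ 1 m⟩)
  map_add' m n := Prod.ext
    (LinearMap.ext fun u => by
      refine Eq.trans (congrArg g (Subtype.ext ?_)) (map_add g _ _)
      exact smul_add (low u : TriRing A U B) m n)
    (Eq.trans (congrArg g (Subtype.ext (smul_add (inr A U B 1) m n))) (map_add g _ _))
  map_smul' t m := Prod.ext
    (LinearMap.ext fun u => congrArg g (Subtype.ext (by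
      change (low u : TriRing A U B) • t • m = (low (op t.a • u) : TriRing A U B) • m
      rw [smul_smul, low_mul])))
    (by
      change g _ = g _ + t.b • g _
      rw [← map_smul, ← map_add]
      refine congrArg g (Subtype.ext ?_)
      change inr A U B 1 • t • m = (low t.u : TriRing A U B) • m + inr A U B t.b • inr A U B 1 • m
      rw [smul_smul, smul_smul, ← add_smul]
      congr 1
      ext <;> simp [inr_apply, low])

variable (A U B) in
/-- The universal property of `(Hom_B(U, N); N)`. -/
def coinducedEquiv (M : ModuleCat.{u} (TriRing A U B)) (N : ModuleCat.{u} B) :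
    ((cornerFunctor (inr A U B)).obj M ⟶ N) ≃
      (M ⟶ ModuleCat.of (TriRing A U B) (Coinduced (B := B) A U N)) where
  toFun g := ModuleCat.ofHom (coinducedLift (M := M) g.hom)
  invFun f := ModuleCat.ofHom (cornerCoinduced.toLinearMap ∘ₗ cornerMap _ f.hom)
  left_inv g := by
    ext m
    exact congrArg g.hom (Subtype.ext m.2)
  right_inv f := by
    ext m
    refine Prod.ext (LinearMap.ext fun u => ?_) ?_
    · refine (congrArg Prod.snd (map_smul f.hom (low u) m)).trans ?_
      change (f.hom m).1 u + (0 : B) • (f.hom m).2 = _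
      rw [zero_smul, add_zero]
    · refine (congrArg Prod.snd ((map_smul f.hom (inr A U B 1) m).trans
        (inr_smul_coinduced 1 (f.hom m)))).trans (one_smul B _)

theorem coinducedEquiv_naturality (M' M : ModuleCat.{u} (TriRing A U B)) (N : ModuleCat.{u} B)
    (f : M' ⟶ M) (g : (cornerFunctor (inr A U B)).obj M ⟶ N) :
    coinducedEquiv A U B M' N ((cornerFunctor (inr A U B)).map f ≫ g) =
      f ≫ coinducedEquiv A U B M N g := by
  ext m
  exact Prod.ext (LinearMap.ext fun u => congrArg g.hom (Subtype.ext (map_smul f.hom _ _)))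
    (congrArg g.hom (Subtype.ext (map_smul f.hom _ _)))

variable (A U B) in
/-- The functor `N ↦ (Hom_B(U, N); N)`. -/
def coinducedFunctor : ModuleCat.{u} B ⥤ ModuleCat.{u} (TriRing A U B) :=
  Adjunction.rightAdjointOfEquiv (coinducedEquiv A U B) coinducedEquiv_naturality

variable (A U B) in
/-- The functor `N ↦ (Hom_B(U, N); N)` is right adjoint to taking the lower component. -/
def coinducedAdj : cornerFunctor (inr A U B) ⊣ coinducedFunctor A U B :=
  Adjunction.adjunctionOfEquivRight (coinducedEquiv A U B) coinducedEquiv_naturality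

/-- `N ↦ (Hom_B(U, N); N)` preserves an epimorphism along which homomorphisms from `U` lift. -/
theorem epi_coinducedFunctor_map {E K : ModuleCat.{u} B} (q : E ⟶ K) [Epi q]
    (h : ∀ f : ModuleCat.of B U ⟶ K, ∃ g : ModuleCat.of B U ⟶ E, g ≫ q = f) :
    Epi ((coinducedFunctor A U B).map q) := by
  rw [ModuleCat.epi_iff_surjective]
  intro (z : Coinduced (B := B) A U K)
  obtain ⟨f, x⟩ := z
  obtain ⟨g, hg⟩ := h (ModuleCat.ofHom f)
  obtain ⟨y, hy⟩ := (ModuleCat.epi_iff_surjective q).1 inferInstance x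
  refine ⟨((g.hom, y) : (U →ₗ[B] E) × E), Prod.ext (LinearMap.ext fun u => ?_) ?_⟩
  · change q.hom (g.hom u + (0 : B) • y) = f u
    rw [zero_smul, add_zero]
    exact congrArg (fun k => k.hom u) hg
  · change q.hom (g.hom (0 : U) + (1 : B) • y) = x
    rw [one_smul, map_zero, zero_add]
    exact hy

end Coinduced

end Functors

/-! ### Exactness of restriction of scalars -/

section RestrictScalars

variable {R S : Type u} [Ring R] [Ring S] (f : R →+* S)

theorem map_restrictScalars_exact (K : ShortComplex (ModuleCat.{u} S)) (h : K.Exact) :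
    (K.map (ModuleCat.restrictScalars.{u} f)).Exact := by
  rw [ShortComplex.ShortExact.moduleCat_exact_iff_function_exact] at h ⊢
  exact h

instance : PreservesFiniteLimits (ModuleCat.restrictScalars.{u} f) := by
  have := ((Functor.exact_tfae (ModuleCat.restrictScalars.{u} f)).out 1 3).1
    (map_restrictScalars_exact f)
  exact this.1

instance : PreservesFiniteColimits (ModuleCat.restrictScalars.{u} f) := by
  have := ((Functor.exact_tfae (ModuleCat.restrictScalars.{u} f)).out 1 3).1
    (map_restrictScalars_exact f)
  exact this.2

end RestrictScalars

/-! ### The gluing applied to the triangular matrix ring -/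

section Main

variable {A B U : Type u} [Ring A] [Ring B] [AddCommGroup U] [Module B U] [Module Aᵐᵒᵖ U]
  [SMulCommClass B Aᵐᵒᵖ U]

open TriRing

theorem exists_hasInjectiveDimensionLT_rightDual (hUA : rightFlatDim A U < ⊤) :
    ∃ n, HasInjectiveDimensionLT (ModuleCat.of A (RightDual U)) (n + 1) :=
  (resolutionDim_lt_top.1 hUA).imp fun _ h => hasInjectiveDimensionLT_rightDual h

theorem exists_hasProjectiveDimensionLT {C : Type*} [Category* C] [Abelian C] {X : C}
    (h : projectiveDimension X < ⊤) : ∃ n : ℕ, HasProjectiveDimensionLT X (n + 1) := by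
  obtain ⟨n, hn⟩ := (projectiveDimension_ne_top_iff X).1 h.ne
  exact ⟨n, hn⟩

/-- The lower component of a projective column satisfies `Ext¹(Q₂, N) = 0` when
`Ext¹(U, N) = 0`. -/
theorem extV_corner_inr_of_projective {Q : ModuleCat.{u} (TriRing A U B)} (hQ : Projective Q)
    {N : ModuleCat.{u} B} (h : ExtV (ModuleCat.of B U) N) :
    ExtV ((cornerFunctor (inr A U B)).obj Q) N := by
  let := HasExt.standard (ModuleCat.{u} B)
  obtain ⟨E, K, i, q, hE, hs⟩ := exists_copresentation N
  refine extV_of_ext fun e => ext_eq_zero_of_exists_lift hs (fun f => ?_) e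
  have := hs.epi
  -- `Ext¹(U, N) = 0` makes `h E ⟶ h K` an epimorphism, so projectivity of `Q` lifts the transpose
  -- `Q ⟶ h K` of `f`.
  have := epi_coinducedFunctor_map (A := A) q fun f => exists_lift_of_ext (extV_iff.1 h) hs f
  let adj := coinducedAdj A U B
  refine ⟨(adj.homEquiv _ _).symm
    (Projective.factorThru (adj.homEquiv _ _ f) ((coinducedFunctor A U B).map q)), ?_⟩
  rw [← adj.homEquiv_naturality_right_symm, Projective.factorThru_comp, Equiv.symm_apply_apply]

/-- The upper component of an injective column satisfies `Ext¹(X, E₁) = 0` when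
`Ext¹(X, Hom(U, ℚ/ℤ)) = 0`. -/
theorem extV_corner_inl_of_injective {E : ModuleCat.{u} (TriRing A U B)} (hE : Injective E)
    {X : ModuleCat.{u} A} (h : ExtV X (ModuleCat.of A (RightDual U))) :
    ExtV X ((cornerFunctor (inl A U B)).obj E) := by
  intro K P i q hs f
  have := hs.mono
  -- The vanishing makes `p K ⟶ p P` a monomorphism, so the transpose `p K ⟶ E` of `f` extends by
  -- injectivity of `E`.
  have := mono_inducedFunctor_map (B := B) i fun f => h i q hs f
  let adj := inducedAdj A U B
  refine ⟨adj.homEquiv _ _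
    (Injective.factorThru ((adj.homEquiv _ _).symm f) ((inducedFunctor A U B).map i)), ?_⟩
  rw [← adj.homEquiv_naturality_left, Injective.comp_factorThru, Equiv.apply_symm_apply]

theorem fg_corner_iff (hUA : rightFlatDim A U < ⊤)
    (hBU : projectiveDimension (ModuleCat.of B U) < ⊤) (hB : ∀ Y : ModuleCat.{u} B, FG Y)
    (M : ModuleCat.{u} (TriRing A U B)) : FG M ↔ FG ((cornerFunctor (inl A U B)).obj M) := by
  have := (coinducedAdj A U B).isLeftAdjoint
  obtain ⟨n, hn⟩ := exists_hasInjectiveDimensionLT_rightDual hUA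
  obtain ⟨m, hm⟩ := exists_hasProjectiveDimensionLT hBU
  refine fg_iff_of_gluing (inducedAdj A U B)
    (cornerAdjRestrict (ι := inl A U B) (fst A U B) inl_one_mul fun _ => rfl)
    (restrictAdjCorner (ι := inr A U B) (snd A U B) mul_inr_one fun _ => rfl)
    (fun M => ⟨_, _, ses_corners M⟩) (fun X => ⟨(cornerTriModuleFst _).toModuleIso⟩) ?_ ?_ hB M
  · intro K P G i q hs _ hG
    have := hs.mono
    -- `Ext¹(G, Hom(U, ℚ/ℤ)) = 0`, the character module having finite injective dimension.
    exact mono_inducedFunctor_map i (extV_of_up isGClass_GP.up hG _ hn i q hs)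
  · exact fun Q hQ => ⟨_, hasProjectiveDimensionLT_of_extV
      (fun _ => extV_corner_inr_of_projective hQ) hm⟩

theorem fg_op_corner_iff (hUA : rightFlatDim A U < ⊤)
    (hBU : projectiveDimension (ModuleCat.of B U) < ⊤)
    (hA : ∀ X : ModuleCat.{u} A, FG (Opposite.op X)) (M : ModuleCat.{u} (TriRing A U B)) :
    FG (Opposite.op M) ↔ FG (Opposite.op ((cornerFunctor (inr A U B)).obj M)) := by
  have := (inducedAdj A U B).isRightAdjoint
  obtain ⟨n, hn⟩ := exists_hasInjectiveDimensionLT_rightDual hUA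
  obtain ⟨m, hm⟩ := exists_hasProjectiveDimensionLT hBU
  refine fg_op_iff_of_gluing (coinducedAdj A U B)
    (cornerAdjRestrict (ι := inl A U B) (fst A U B) inl_one_mul fun _ => rfl)
    (restrictAdjCorner (ι := inr A U B) (snd A U B) mul_inr_one fun _ => rfl)
    (fun M => ⟨_, _, ses_corners M⟩) (fun X => ⟨cornerCoinduced.toModuleIso⟩) ?_ ?_ hA M
  · intro G E K i q hs _ hG
    have := hs.epi
    refine epi_coinducedFunctor_map q fun f => ?_
    -- `Ext¹(U, G) = 0` for Gorenstein injective `G`, as `U` has finite projective dimension; hence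
    -- `Hom_B(U, -)` keeps `E ⟶ K` epic.
    obtain ⟨g, hg⟩ := extV_of_up isGClass_GP.up hG _ (hasInjectiveDimensionLT_op hm)
      q.op i.op hs.op f.op
    exact ⟨g.unop, congrArg Quiver.Hom.unop hg⟩
  · exact fun E hE => ⟨_, hasInjectiveDimensionLT_of_extV
      (fun _ => extV_corner_inl_of_injective hE) hn⟩

end Main

end TriangularGorenstein

end

theorem theorem2p7 {A B U : Type u} [Ring A] [Ring B] [AddCommGroup U]
    [Module B U] [Module Aᵐᵒᵖ U] [SMulCommClass B Aᵐᵒᵖ U]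
    (hUA : rightFlatDim A U < ⊤)
    (hBU : projectiveDimension (ModuleCat.of B U) < ⊤)
    {M₁ M₂ : Type u} [AddCommGroup M₁] [Module A M₁] [AddCommGroup M₂] [Module B M₂]
    (φ : BalancedTensor B A U M₁ →ₗ[B] M₂) :
    (LeftGorensteinRegular B →
      (Gpd (TriRing A U B) (TriModule φ) < ⊤ ↔ Gpd A M₁ < ⊤ ∧ Gpd B M₂ < ⊤)) ∧
    (LeftGorensteinRegular A →
      (Gid (TriRing A U B) (TriModule φ) < ⊤ ↔ Gid A M₁ < ⊤ ∧ Gid B M₂ < ⊤)) := by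
  constructor
  · intro hB
    have hM₂ : FG (ModuleCat.of B M₂) := (hB.fg _).1
    have e := (cornerTriModuleFst φ).toModuleIso
    rw [gpd_lt_top_iff, gpd_lt_top_iff, gpd_lt_top_iff,
      fg_corner_iff hUA hBU fun Y => (hB.fg Y).1, and_iff_left hM₂]
    exact ⟨fun h => h.of_iso e, fun h => h.of_iso e.symm⟩
  · intro hA
    have hM₁ : FG (Opposite.op (ModuleCat.of A M₁)) := (hA.fg _).2
    have e := (cornerTriModuleSnd φ).toModuleIso
    rw [gid_lt_top_iff, gid_lt_top_iff, gid_lt_top_iff,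
      fg_op_corner_iff hUA hBU fun X => (hA.fg X).2, and_iff_right hM₁]
    exact ⟨fun h => h.of_iso e.symm.op, fun h => h.of_iso e.op⟩
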